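/- **Setting.** Let the exponent set $A$ be $\mathbb Z$ (discrete theory) or $\mathbb R$ (continuous theory); coefficients are complex. Let $\lfloor a\rceil!=\Gamma(a+1)$ if $a$ is not a negative integer and $\lfloor -n-1\rceil!=(-1)^n/n!$ for $n\in\mathbb N$. For a finitely supported integer vector $\alpha=(\alpha_1,\alpha_2,\dots)$ put $\ell^\alpha=(\log x)^{\alpha_1}(\log\log x)^{\alpha_2}\cdots$, and let the harmonic logarithms be $$\lambda_a^\alpha(x)=\lfloor a\rceil!\,x^a\sum_{k\ge0}s(-a,k)\Big(x\frac{d}{dx}\Big)^k\ell^\alpha,\qquad \sum_k s(-a,k)s^k=\frac{\Gamma(1+s)}{\Gamma(a+1+s)} .$$ An *Artinian operator* is a formal series $f(D)=\sum_{a\in A}f_aD^a$ with well-ordered support; it acts, for $\alpha\ne(0)$, on the series $\sum_b c_b\lambda_b^\alpha$ whose support satisfies the ascending chain condition, by $D^b\lambda_a^\alpha=\frac{\lfloor a\rceil!}{\lfloor a-b\rceil!}\lambda_{a-b}^\alpha$. Write $\langle p\rangle_\alpha$ for the coefficient of $\lambda_0^\alpha$ in $p$. A *delta operator* is an Artinian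 operator of degree one, $f=f_1D(1+u)$ with $f_1\neq0$ and $u$ of positive degree; it is *standard* if $f_1$ is a positive real number. Put $f^{a;0}=f_1^aD^a\sum_k\binom ak u^k$ (principal value of $f_1^a$; for $A=\mathbb Z$ this is the usual power $f^a$), and $h(f)=h(f;0)=\sum_a h_af^{a;0}$. A *graded sequence* $\mathbf p$ is a family $p_a^\alpha(x)=\sum_{b\le a}c_{ab}\lambda_b^\alpha(x)$, $a\in A$, with coefficients independent of $\alpha$ and $c_{aa}\ne0$, such that $\lambda_a^\alpha\mapsto p_a^\alpha$ extends to infinite sums: for every set $S\subseteq A$ satisfying the ascending chain condition, $\{b:\exists a\in S,\ c_{ab}\neq0\}$ satisfies it too, and $\{a\in S:c_{ab}\ne0\}$ is finite for each $b$ (for $A=\mathbb Z$ this is automatic). The *umbral composition* of $\mathbf q$ with $\mathbf p$ is $q_a^\alpha(\mathbf p)=\sum_b[\lambda_b^\alpha]q_a^\alpha\; p_b^\alpha(x)$. The graded sequence $\mathbf p$ is the *(standard) associated* sequence of the delta operator $f(D)$ if $\langle f(D)^{b;0}p_a^\alpha\rangle_\alpha=\lfloor a\rceil!\,\delta_{ab}$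 for all $a,b$ and all $\alpha\neq(0)$. It is a *Roman graded sequence* if $$\langle f(D)g(D)p_a^\alpha\rangle_\alpha=\sum_b\frac{\lfloor a\rceil!}{\lfloor b\rceil!\lfloor a-b\rceil!}\langle f(D)p_b^\alpha\rangle_\alpha\langle g(D)p_{a-b}^\alpha\rangle_\alpha$$ (a finite sum) for all Artinian operators $f(D),g(D)$, all $a$ and all $\alpha\neq(0)$. A *standard Roman graded sequence* is a Roman graded sequence that is the standard associated sequence of a standard delta operator. **Corollary (Inverses).** Let $A=\mathbb Z$ (respectively $A=\mathbb R$), and let $\mathbf p$ and $\mathbf q$ be the graded sequences (standard) associated with the delta operators (respectively the standard delta operators) $f(D)$ and $g(D)$. Then the following are equivalent: 1. $f(g)=D$ (respectively $f(g;0)=D$); 2. $g(f)=D$ (respectively $g(f;0)=D$); 3. $q_n^\alpha(\mathbf p)=\lambda_n^\alpha(x)$ for all $n\in A$ and all $\alpha$; 4. $p_n^\alpha(\mathbf q)=\lambda_n^\alpha(x)$ for all $n\in A$ and all $\alpha$. Moreover, the delta operators form a group under composition with identity $D$ (respectively, the standard delta operators under $0$-composition); the Roman graded sequences (respectively the standard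 Roman graded sequences) form a group under umbral composition, with product $\mathbf p\cdot\mathbf q=\big(p_a^\alpha(\mathbf q)\big)$ and identity $\big(\lambda_a^\alpha\big)$; and sending a delta operator to its unique (standard) associated graded sequence is an isomorphism of the first group onto the second. -/

import Mathlib

open scoped Nat

noncomputable section

namespace IterLog

theorem exists_ne_zero_of_finsum {ι : Type*} {u : ι → ℂ} (h : ∑ᶠ i, u i ≠ 0) : ∃ i, u i ≠ 0 := by
  by_contra! hu
  exact h (finsum_eq_zero_of_forall_eq_zero hu)

/-! ### Iterated logarithms and harmonic logarithms -/

/-- A vector `α = (α₁, α₂, …)` of integers with finitely many nonzero entries, indexed from `0`.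
It stands for the monomial `ℓ^α = (log x)^α₁ (log log x)^α₂ ⋯`. -/
abbrev LogExp : Type := ℕ →₀ ℤ

/-- The derivation `x d/dx` on the span of the monomials `ℓ^α`. As the derivative of the
`(i+1)`-fold logarithm `ℓᵢ` is `1 / (x ℓ₀ ⋯ ℓᵢ₋₁)`, it sends `ℓ^α` to
`∑ᵢ αᵢ ℓ^α / (ℓ₀ ℓ₁ ⋯ ℓᵢ)`. -/
def logDeriv : (LogExp →₀ ℂ) →ₗ[ℂ] (LogExp →₀ ℂ) :=
  Finsupp.linearCombination ℂ fun α : LogExp =>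
    ∑ i ∈ α.support,
      Finsupp.single (α - ∑ j ∈ Finset.range (i + 1), Finsupp.single j 1) ((α i : ℤ) : ℂ)

/-- The Roman factorial `⌊a⌉!`: it is `Γ(a + 1)` unless `a` is a negative integer, and
`⌊-n-1⌉! = (-1)^n / n!` for natural numbers `n`. -/
def romanFactorial (a : ℝ) : ℝ :=
  if a = -((⌊-a - 1⌋₊ : ℝ) + 1) then (-1) ^ ⌊-a - 1⌋₊ / (⌊-a - 1⌋₊ ! : ℝ)
  else Real.Gamma (a + 1)

/-- The coefficient of `s^k` in the Taylor series at `s = 0` of the (near `0` holomorphic)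
function `Γ(1 + s) / Γ(a + 1 + s)`; equivalently the (generalized) Stirling number `s(-a, k)`. -/
def stirlingCoeff (a : ℝ) (k : ℕ) : ℂ :=
  iteratedDeriv k (fun s : ℂ => Complex.Gamma (1 + s) / Complex.Gamma ((a : ℂ) + 1 + s)) 0 / (k ! : ℂ)

section Exponents

/-! `A` is the ring of exponents: `A = ℤ` gives the discrete theory, `A = ℝ` the continuous one. -/

variable {A : Type} [CommRing A] [LinearOrder A] [IsStrictOrderedRing A] [Algebra A ℝ]

/-- A formal series of logarithmic type, given by its coefficients: `P a α` is the coefficient of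
`x^a ℓ^α`. -/
abbrev LogSeries (A : Type) : Type := A → LogExp → ℂ

/-- The harmonic logarithm
`λ_a^α(x) = ⌊a⌉! x^a ∑ₖ s(-a, k) (x d/dx)^k ℓ^α`.
Each application of `x d/dx` lowers the exponent of `log x` by exactly one, so that only finitely
many `k` contribute to each coefficient. In particular `λ_0^α = ℓ^α`, the derivative of `λ_a^α` is
`⌊a⌉ λ_{a-1}^α` (where `⌊a⌉ = a` for `a ≠ 0` and `⌊0⌉ = 1`), and `λ_a^(0)` is `x^a`, or `0` if `a`
is a negative integer. -/
def harmonicLog (a : A) (α : LogExp) : LogSeries A := fun b β =>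
  if b = a then
    (romanFactorial (algebraMap A ℝ a) : ℂ) *
      ∑ᶠ k : ℕ, stirlingCoeff (algebraMap A ℝ a) k * (logDeriv ^ k) (Finsupp.single α 1) β
  else 0

/-! ### Artinian operators

An Artinian operator `f(D) = ∑ f_a D^a` is a formal series whose support satisfies the descending
chain condition, that is, an element of `HahnSeries A ℂ` (a Laurent series if `A = ℤ`). -/

/-- The delta operators: the Artinian operators of degree one. -/
def IsDelta (f : HahnSeries A ℂ) : Prop :=
  (∀ a < 1, f.coeff a = 0) ∧ f.coeff 1 ≠ 0

/-- The standard delta operators: those whose leading coefficient is a positive real number. -/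
def IsStandardDelta (f : HahnSeries A ℂ) : Prop :=
  (∀ a < 1, f.coeff a = 0) ∧ ∃ r : ℝ, 0 < r ∧ f.coeff 1 = (r : ℂ)

/-- The derivative `D`. -/
def opD (A : Type) [CommRing A] [LinearOrder A] : HahnSeries A ℂ :=
  HahnSeries.single 1 1

/-- The normalization `f(D) / (f₁ D)` of a delta operator, a series of the form `1 + u` with `u` of
positive degree. -/
def unitPart (f : HahnSeries A ℂ) : HahnSeries A ℂ :=
  HahnSeries.single (-1) (f.coeff 1)⁻¹ * f

/-- The power `f(D)^{a;0}` of a delta operator `f = f₁ D (1 + u)`, namely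
`f₁^a D^a ∑ₖ (a choose k) u^k`, where `f₁^a` is the principal value (for `A = ℤ` this is the usual
`a`-th power of `f`). -/
def opPow (f : HahnSeries A ℂ) (a : A) : HahnSeries A ℂ :=
  HahnSeries.single a ((f.coeff 1) ^ ((algebraMap A ℝ a : ℝ) : ℂ)) *
    (HahnSeries.SummableFamily.binomialFamily (unitPart f)
      ((algebraMap A ℝ a : ℝ) : ℂ)).hsum

/-- The summable family of the terms `h_a D^a` of a series `h(D)`. -/
def termFamily (h : HahnSeries A ℂ) : HahnSeries.SummableFamily A ℂ A where
  toFun a := HahnSeries.single a (h.coeff a)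
  isPWO_iUnion_support' := by
    refine h.isPWO_support.mono fun x hx => ?_
    obtain ⟨a, ha⟩ := Set.mem_iUnion.1 hx
    have hxa : x = a := by
      by_contra hne
      exact ha (HahnSeries.coeff_single_of_ne hne)
    subst hxa
    simpa using ha
  finite_co_support' g := by
    refine (Set.finite_singleton g).subset fun a ha => ?_
    by_contra hne
    exact ha (HahnSeries.coeff_single_of_ne fun h => hne h.symm)

/-- The summable family of the `h_a f₁^a D^a (a choose k) u^k`, where `f = f₁ D (1 + u)`. -/
def compDoubleFamily (h f : HahnSeries A ℂ) : HahnSeries.SummableFamily A ℂ (A × ℕ) :=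
  HahnSeries.SummableFamily.smulFamily
    (fun ak : A × ℕ => (f.coeff 1) ^ ((algebraMap A ℝ ak.1 : ℝ) : ℂ) *
      Ring.choose ((algebraMap A ℝ ak.1 : ℝ) : ℂ) ak.2)
    ((termFamily h).mul (HahnSeries.SummableFamily.powers (unitPart f - 1)))

theorem coeff_smul_opPow (h f : HahnSeries A ℂ) (a g : A) :
    (h.coeff a • opPow f a).coeff g = ∑ᶠ k : ℕ, (compDoubleFamily h f (a, k)).coeff g := by
  have hk : ∀ k : ℕ, (compDoubleFamily h f (a, k)).coeff g =
      (h.coeff a * (f.coeff 1) ^ ((algebraMap A ℝ a : ℝ) : ℂ)) *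
        (HahnSeries.SummableFamily.binomialFamily (unitPart f)
          ((algebraMap A ℝ a : ℝ) : ℂ) k).coeff (g - a) := by
    intro k
    simp only [compDoubleFamily, termFamily, HahnSeries.SummableFamily.smulFamily_toFun,
      HahnSeries.SummableFamily.mul_toFun, HahnSeries.SummableFamily.coe_mk,
      HahnSeries.coeff_smul, HahnSeries.coeff_single_mul, smul_eq_mul,
      HahnSeries.SummableFamily.binomialFamily, PowerSeries.binomialSeries_coeff, mul_one]
    ring
  rw [finsum_congr hk, HahnSeries.coeff_smul, opPow, HahnSeries.coeff_single_mul,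
    HahnSeries.SummableFamily.coeff_hsum, smul_eq_mul, ← mul_assoc, mul_finsum]

/-- The summable family of the `h_a f(D)^{a;0}`. -/
def compFamily (h f : HahnSeries A ℂ) : HahnSeries.SummableFamily A ℂ A where
  toFun a := h.coeff a • opPow f a
  isPWO_iUnion_support' := by
    refine (compDoubleFamily h f).isPWO_iUnion_support.mono fun g hg => ?_
    obtain ⟨a, ha⟩ := Set.mem_iUnion.1 hg
    rw [HahnSeries.mem_support, coeff_smul_opPow] at ha
    obtain ⟨k, hk⟩ := exists_ne_zero_of_finsum ha
    exact Set.mem_iUnion.2 ⟨(a, k), hk⟩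
  finite_co_support' g := by
    refine (((compDoubleFamily h f).finite_co_support g).image Prod.fst).subset fun a ha => ?_
    have ha' : (h.coeff a • opPow f a).coeff g ≠ 0 := ha
    rw [coeff_smul_opPow] at ha'
    obtain ⟨k, hk⟩ := exists_ne_zero_of_finsum ha'
    exact ⟨(a, k), hk, rfl⟩

/-- The (`0`-)composition `h(f) = h(f;0) = ∑ₐ h_a f(D)^{a;0}` of an Artinian operator `h(D)` with a
delta operator `f(D)`. -/
def opComp (h f : HahnSeries A ℂ) : HahnSeries A ℂ := (compFamily h f).hsum

/-! ### Graded sequences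

The elements of `𝓘^α` are the series `∑ c_b λ_b^α(x)` whose support satisfies the ascending chain
condition. -/

/-- A (regular) graded sequence: a sequence `p_a^α(x) = ∑_b c_{ab} λ_b^α(x)` of elements of `𝓘^α`,
of degree exactly `a`, whose coefficients `c_{ab} = [λ_b^α(x)] p_a^α(x)` do not depend on `α`, and
such that `λ_a^α ↦ p_a^α` extends to arbitrary elements of `𝓘^α`: if the set `S` satisfies the
ascending chain condition then so does the set of all `b` with `c_{ab} ≠ 0` for some `a ∈ S`, and
each `b` occurs for finitely many `a ∈ S` only. (The last condition is automatic if `A = ℤ`. With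
`S = {a}` it says that `p_a^α` lies in `𝓘^α`.) -/
@[ext]
structure GradedSequence (A : Type) [LinearOrder A] where
  /-- The coefficients `c_{ab}`. -/
  coeff : A → A → ℂ
  coeff_of_lt : ∀ a b, a < b → coeff a b = 0
  coeff_self : ∀ a, coeff a a ≠ 0
  noetherian : ∀ S : Set A, S.WellFoundedOn (· > ·) →
    {b | ∃ a ∈ S, coeff a b ≠ 0}.WellFoundedOn (· > ·)
  finite : ∀ S : Set A, S.WellFoundedOn (· > ·) → ∀ b, {a ∈ S | coeff a b ≠ 0}.Finite

namespace GradedSequence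

/-- The series `p_a^α(x) = ∑_b c_{ab} λ_b^α(x)`. -/
def series (p : GradedSequence A) (a : A) (α : LogExp) : LogSeries A := fun b β =>
  ∑ᶠ d : A, p.coeff a d * harmonicLog d α b β

/-- The graded sequence of the harmonic logarithms `λ_a^α(x)`. -/
def harmonic (A : Type) [LinearOrder A] : GradedSequence A where
  coeff a b := if a = b then 1 else 0
  coeff_of_lt a b h := if_neg h.ne
  coeff_self a := by simp
  noetherian S hS := hS.subset fun b hb => by
    obtain ⟨a, ha, hab⟩ := hb
    have : a = b := by
      by_contra hne
      exact hab (if_neg hne)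
    exact this ▸ ha
  finite S _ b := (Set.finite_singleton b).subset fun a ha => by
    by_contra hne
    exact ha.2 (if_neg hne)

/-- The umbral composition `q_a^α(𝐩) = ∑_b [λ_b^α(x)] q_a^α(x) · p_b^α(x)`; only finitely many `b`
contribute to each coefficient. -/
def umbral {A : Type} [LinearOrder A] (q p : GradedSequence A) : GradedSequence A where
  coeff a d := ∑ᶠ b : A, q.coeff a b * p.coeff b d
  coeff_of_lt a d h := by
    refine finsum_eq_zero_of_forall_eq_zero fun b => ?_
    rcases lt_or_ge a b with hb | hb
    · rw [q.coeff_of_lt a b hb, zero_mul]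
    · rw [p.coeff_of_lt b d (lt_of_le_of_lt hb h), mul_zero]
  coeff_self a := by
    rw [finsum_eq_single _ a]
    · exact mul_ne_zero (q.coeff_self a) (p.coeff_self a)
    · intro b hb
      rcases lt_or_gt_of_ne hb with hb | hb
      · rw [p.coeff_of_lt b a hb, mul_zero]
      · rw [q.coeff_of_lt a b hb, zero_mul]
  noetherian S hS := by
    refine (p.noetherian _ (q.noetherian S hS)).subset ?_
    rintro d ⟨a, ha, had⟩
    obtain ⟨b, hb⟩ := exists_ne_zero_of_finsum had
    exact ⟨b, ⟨a, ha, left_ne_zero_of_mul hb⟩, right_ne_zero_of_mul hb⟩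
  finite S hS d := by
    refine ((p.finite _ (q.noetherian S hS) d).biUnion fun b _ => q.finite S hS b).subset ?_
    rintro a ⟨ha, had⟩
    obtain ⟨b, hb⟩ := exists_ne_zero_of_finsum had
    exact Set.mem_biUnion (x := b) ⟨⟨a, ha, left_ne_zero_of_mul hb⟩, right_ne_zero_of_mul hb⟩
      ⟨ha, left_ne_zero_of_mul hb⟩

end GradedSequence

/-- The action of an Artinian operator `h(D)` on an element `∑ c_d λ_d^α` of `𝓘^α`, `α ≠ (0)`, both
sides being given by their coefficients in the harmonic logarithms. As
`D^b λ_d^α = (⌊d⌉! / ⌊d - b⌉!) λ_{d-b}^α`, the coefficient of `λ_e^α` in the result is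
`∑_d h_{d-e} (⌊d⌉! / ⌊e⌉!) c_d`. -/
def opAct (h : HahnSeries A ℂ) (c : A → ℂ) : A → ℂ := fun e =>
  ∑ᶠ d : A, h.coeff (d - e) *
    ((romanFactorial (algebraMap A ℝ d) / romanFactorial (algebraMap A ℝ e) : ℝ) : ℂ) * c d

/-- The augmentation `⟨h(D) p_a^α(x)⟩_α` for `α ≠ (0)`: the coefficient of `λ_0^α` in
`h(D) p_a^α(x)`, which is the same for all `α ≠ (0)`. -/
def augment (h : HahnSeries A ℂ) (p : GradedSequence A) (a : A) : ℂ :=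
  opAct h (p.coeff a) 0

/-- `p` is the (standard, that is `0`-th) associated graded sequence of the delta operator `f(D)`:
`⟨f(D)^{b;0} p_a^α(x)⟩_α = ⌊a⌉! δ_{ab}` for all `a`, `b` and all `α ≠ (0)`. -/
def IsAssociated (f : HahnSeries A ℂ) (p : GradedSequence A) : Prop :=
  ∀ a b : A, augment (opPow f b) p a =
    if a = b then (romanFactorial (algebraMap A ℝ a) : ℂ) else 0

/-- The Roman coefficient `⌊a⌉! / (⌊b⌉! ⌊a - b⌉!)`. -/
def romanCoeff (a b : ℝ) : ℝ :=
  romanFactorial a / (romanFactorial b * romanFactorial (a - b))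

/-- The Roman graded sequences: for all Artinian operators `f(D)`, `g(D)`, all `a` and `α ≠ (0)`,
`⟨f(D) g(D) p_a^α⟩_α = ∑_b ⌊a choose b⌉ ⟨f(D) p_b^α⟩_α ⟨g(D) p_{a-b}^α⟩_α`, a finite sum. -/
def IsRoman (p : GradedSequence A) : Prop :=
  ∀ (f g : HahnSeries A ℂ) (a : A),
    {b : A | augment f p b * augment g p (a - b) ≠ 0}.Finite ∧
    augment (f * g) p a =
      ∑ᶠ b : A, (romanCoeff (algebraMap A ℝ a) (algebraMap A ℝ b) : ℂ) *
        augment f p b * augment g p (a - b)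

/-- The standard Roman graded sequences: the Roman graded sequences that are the standard associated
graded sequence of a standard delta operator. -/
def IsStandardRoman (p : GradedSequence A) : Prop :=
  IsRoman p ∧ ∃ f : HahnSeries A ℂ, IsStandardDelta f ∧ IsAssociated f p

end Exponents

end IterLog

end

noncomputable section

set_option linter.unusedSectionVars false

namespace IterLog

open HahnSeries HahnSeries.SummableFamily

/-! ### Finite sums and polynomial identities -/

section Finsum

/-! Attach to a delta operator `e` the sequence with coefficients `c_{ad} = (⌊a⌉!/⌊d⌉!) [D^a]
e^{d;0}` (`powerSequence`). The factorials cancel against those produced by the action of `D^d`, so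
`⟨h(D) p_a⟩ = ⌊a⌉! [D^a] h(e)` for every Artinian `h` (`augment_powerSequence`): augmentation is
substitution of `e`. Substitution is multiplicative (`opComp_mul`), so the sequence is Roman. Taking
`h = f^{b;0}` with `f(e) = D` shows that it is associated with `f`; expanding an arbitrary `h` in
the powers of `f` shows that nothing else is. Umbral composition of the sequences of `e` and `e'`
gives that of `e'(e)`. This reverses the order, and passing from `f` to its inverse reverses it
again, so `f ↦ powerSequence f⁻¹` is an isomorphism. The four equivalent conditions then say `fg =
1` or `gf = 1` in one group.

Associativity rests on the power law `f(g)^{a;0} = f^{a;0}(g)`. For the normalized parts it needs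
`(xy)^s = x^s y^s`, which in each coefficient is an identity of polynomials in `s`, true for natural
`s`. For the leading coefficients it needs `(cd)^a = c^a d^a`, which holds for integer `a`, and for
real `a` if `c, d > 0`; `IsPowerGroup` isolates this and treats both theories at once. Inverses come
from a triangular system solved along a well-ordered set of exponents.

Over `ℤ`, the Roman identity says that `h ↦ ∑ ⟨h(D) p_a⟩/⌊a⌉! D^a` is multiplicative, so it sends
`D^d` to the `d`-th power of the image of `D`, and every Roman sequence is a power sequence. Over
`ℝ`, association is part of the definition. -/

theorem finsum_comm_of_finite {ι κ : Type*} (F : ι → κ → ℂ)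
    (h : {x : ι × κ | F x.1 x.2 ≠ 0}.Finite) :
    ∑ᶠ i, ∑ᶠ j, F i j = ∑ᶠ j, ∑ᶠ i, F i j := by
  rw [← finsum_curry (fun x : ι × κ => F x.1 x.2) h,
    ← finsum_comp_equiv (Equiv.prodComm κ ι)]
  refine finsum_curry (fun x : κ × ι => F x.2 x.1) ?_
  exact (h.preimage (Equiv.prodComm κ ι).injective.injOn)

/-- The polynomial whose value at `s` is the binomial coefficient `s choose k`. -/
def choosePoly (k : ℕ) : Polynomial ℂ :=
  Polynomial.C ((k ! : ℂ)⁻¹) * descPochhammer ℂ k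

theorem eval_choosePoly (k : ℕ) (s : ℂ) : (choosePoly k).eval s = Ring.choose s k := by
  rw [Ring.choose_eq_smul, choosePoly, Polynomial.eval_mul, Polynomial.eval_C, smul_eq_mul,
    ← descPochhammer_map (algebraMap ℤ ℂ), Polynomial.eval_map, Polynomial.eval₂_eq_sum,
    Polynomial.smeval_eq_sum]
  congr 1
  exact congrArg _ (funext₂ fun n a => by simp [Polynomial.smul_pow, zsmul_eq_mul])

theorem exists_polynomial_finsum {ι : Type*} (F : ι → Polynomial ℂ) (c : ι → ℂ)
    (hc : {i | c i ≠ 0}.Finite) :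
    ∃ P : Polynomial ℂ, ∀ s : ℂ, ∑ᶠ i, (F i).eval s * c i = P.eval s := by
  refine ⟨∑ i ∈ hc.toFinset, F i * Polynomial.C (c i), fun s => ?_⟩
  rw [finsum_eq_sum_of_support_subset (s := hc.toFinset), Polynomial.eval_finsetSum]
  · simp
  · intro i hi
    simpa using right_ne_zero_of_mul hi

theorem polynomial_ext_nat {P Q : Polynomial ℂ} (h : ∀ n : ℕ, P.eval (n : ℂ) = Q.eval (n : ℂ)) :
    P = Q := by
  refine Polynomial.eq_of_infinite_eval_eq P Q ?_
  refine (Set.infinite_range_of_injective (Nat.cast_injective (R := ℂ))).mono ?_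
  rintro _ ⟨n, rfl⟩
  exact h n

end Finsum

/-! ### Complex powers of series `1 + u` -/

section Binomial

variable {A : Type} [CommRing A] [LinearOrder A] [IsStrictOrderedRing A]

/-- The power `x^s = ∑ₖ (s choose k) (x - 1)^k` of a series `x` with constant leading term `1`. -/
def onePow (x : HahnSeries A ℂ) (s : ℂ) : HahnSeries A ℂ := (binomialFamily x s).hsum

theorem onePow_eq_heval (x : HahnSeries A ℂ) (s : ℂ) :
    onePow x s = PowerSeries.heval (x - 1) (PowerSeries.binomialSeries ℂ s) := rfl

/-- Vandermonde's identity for binomial power series, carried over by the ring homomorphism of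
evaluation at `x - 1`. -/
theorem onePow_add (x : HahnSeries A ℂ) (s t : ℂ) :
    onePow x (s + t) = onePow x s * onePow x t := by
  simp only [onePow_eq_heval, PowerSeries.binomialSeries_add, map_mul]

theorem onePow_zero (x : HahnSeries A ℂ) : onePow x 0 = 1 := by
  simp only [onePow_eq_heval, PowerSeries.binomialSeries_zero, map_one]

theorem onePow_natCast {x : HahnSeries A ℂ} (hx : 0 < (x - 1).orderTop) (n : ℕ) :
    onePow x n = x ^ n := by
  rw [onePow_eq_heval, PowerSeries.binomialSeries_nat, map_pow, map_add, map_one,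
    PowerSeries.heval_X _ hx, add_sub_cancel]

theorem one_onePow (s : ℂ) : onePow (1 : HahnSeries A ℂ) s = 1 := by
  rw [onePow_eq_heval, sub_self, PowerSeries.heval_apply, powerSeriesFamily_hsum_zero]
  simp

theorem orderTop_mul_sub_one_pos {x y : HahnSeries A ℂ} (hx : 0 < (x - 1).orderTop)
    (hy : 0 < (y - 1).orderTop) : 0 < (x * y - 1).orderTop := by
  have := ((toOrderTopSubOnePos hx) * (toOrderTopSubOnePos hy)).2
  simpa using this

theorem coeff_onePow (x : HahnSeries A ℂ) (s : ℂ) (d : A) :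
    (onePow x s).coeff d = ∑ᶠ k : ℕ, (choosePoly k).eval s * (powers (x - 1) k).coeff d := by
  rw [onePow, coeff_hsum]
  refine finsum_congr fun k => ?_
  simp only [binomialFamily, smulFamily_toFun, PowerSeries.binomialSeries_coeff,
    HahnSeries.coeff_smul, smul_eq_mul, mul_one, eval_choosePoly]

theorem smul_mul_smul_series (a b : ℂ) (u v : HahnSeries A ℂ) :
    (a • u) * (b • v) = (a * b) • (u * v) := by
  rw [← C_mul_eq_smul, ← C_mul_eq_smul, ← C_mul_eq_smul, map_mul]
  ring

theorem coeff_onePow_mul (x y : HahnSeries A ℂ) (s : ℂ) (d : A) :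
    (onePow x s * onePow y s).coeff d = ∑ᶠ k : ℕ × ℕ,
      (choosePoly k.1 * choosePoly k.2).eval s *
        (powers (x - 1) k.1 * powers (y - 1) k.2).coeff d := by
  rw [onePow, onePow, ← hsum_mul, coeff_hsum]
  refine finsum_congr fun k => ?_
  simp only [mul_toFun, binomialFamily, smulFamily_toFun, PowerSeries.binomialSeries_coeff,
    smul_eq_mul, mul_one, Polynomial.eval_mul, eval_choosePoly]
  rw [smul_mul_smul_series, HahnSeries.coeff_smul, smul_eq_mul]

/-- Only finitely many binomial terms reach a given exponent `d`, so both coefficients are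
polynomials in `s`; they agree at every natural number, hence everywhere. -/
theorem mul_onePow {x y : HahnSeries A ℂ} (hx : 0 < (x - 1).orderTop)
    (hy : 0 < (y - 1).orderTop) (s : ℂ) : onePow (x * y) s = onePow x s * onePow y s := by
  ext d
  obtain ⟨P, hP⟩ := exists_polynomial_finsum choosePoly
    (fun k => (powers (x * y - 1) k).coeff d) ((powers (x * y - 1)).finite_co_support d)
  obtain ⟨Q, hQ⟩ := exists_polynomial_finsum
    (fun k : ℕ × ℕ => choosePoly k.1 * choosePoly k.2)
    (fun k => (powers (x - 1) k.1 * powers (y - 1) k.2).coeff d)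
    (((powers (x - 1)).mul (powers (y - 1))).finite_co_support' d)
  have hPQ : P = Q := polynomial_ext_nat fun n => by
    rw [← hP, ← hQ, ← coeff_onePow, ← coeff_onePow_mul, onePow_natCast hx, onePow_natCast hy,
      onePow_natCast (orderTop_mul_sub_one_pos hx hy), mul_pow]
  rw [coeff_onePow, coeff_onePow_mul, hP, hQ, hPQ]

/-- The bound does not depend on `s`: this uniformity makes infinite sums of powers with varying
exponents summable. -/
theorem support_onePow_subset (x : HahnSeries A ℂ) (s : ℂ) :
    (onePow x s).support ⊆ AddSubmonoid.closure (x - 1).support := by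
  intro d hd
  rw [HahnSeries.mem_support, coeff_onePow] at hd
  obtain ⟨k, hk⟩ := exists_ne_zero_of_finsum hd
  have hk' := right_ne_zero_of_mul hk
  rw [powers_toFun] at hk'
  split_ifs at hk' with h
  · exact support_pow_subset_closure _ k hk'
  -- Without positive order, `powers` defaults to the powers of `0`, and only the term `k = 0`,
  -- which is `1`, survives.
  · rcases k with _ | k
    · have : d = 0 := by
        by_contra hne
        simp [hne] at hk'
      exact this ▸ zero_mem _
    · simp at hk'

theorem coeff_onePow_zero (x : HahnSeries A ℂ) (s : ℂ) : (onePow x s).coeff 0 = 1 := by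
  rw [onePow_eq_heval, PowerSeries.coeff_heval_zero]
  simp

end Binomial

/-! ### Delta operators, their powers, and composition -/

section Operators

variable {A : Type} [CommRing A] [LinearOrder A]

theorem orderTop_pos_iff {x : HahnSeries A ℂ} :
    0 < x.orderTop ↔ ∀ g ≤ 0, x.coeff g = 0 := by
  constructor
  · intro h g hg
    exact coeff_eq_zero_of_lt_orderTop (lt_of_le_of_lt (by exact_mod_cast hg) h)
  · intro h
    rcases eq_or_ne x 0 with rfl | hx
    · simp
    · rw [zero_lt_orderTop_iff hx]
      by_contra! hle
      exact coeff_order_eq_zero.not.2 hx (h _ hle)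

variable [IsStrictOrderedRing A]

section UnitPart

theorem coeff_unitPart (f : HahnSeries A ℂ) (g : A) :
    (unitPart f).coeff g = (f.coeff 1)⁻¹ * f.coeff (g + 1) := by
  rw [unitPart, coeff_single_mul, sub_neg_eq_add]

theorem unitPart_sub_one_orderTop_pos {f : HahnSeries A ℂ} (hf : IsDelta f) :
    0 < (unitPart f - 1).orderTop := by
  refine orderTop_pos_iff.2 fun g hg => ?_
  rw [coeff_sub, coeff_unitPart, coeff_one]
  rcases hg.lt_or_eq with hg | rfl
  · rw [hf.1 (g + 1) (by linarith), if_neg hg.ne]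
    simp
  · simp [hf.2]

theorem single_mul_unitPart {f : HahnSeries A ℂ} (hf : f.coeff 1 ≠ 0) :
    single 1 (f.coeff 1) * unitPart f = f := by
  rw [unitPart, ← mul_assoc, single_mul_single, add_neg_cancel, mul_inv_cancel₀ hf,
    single_zero_one, one_mul]

/-- A series of the form `c D (1 + u)` with `u` of positive degree is a delta operator with leading
coefficient `c` and normalization `1 + u`. -/
theorem coeff_one_single_mul {x : HahnSeries A ℂ} (c : ℂ) (hx : 0 < (x - 1).orderTop) :
    (single (1 : A) c * x).coeff 1 = c := by
  have h := orderTop_pos_iff.1 hx 0 le_rfl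
  rw [coeff_sub, coeff_one, if_pos rfl, sub_eq_zero] at h
  rw [coeff_single_mul, sub_self, h, mul_one]

theorem unitPart_single_mul {x : HahnSeries A ℂ} {c : ℂ} (hc : c ≠ 0)
    (hx : 0 < (x - 1).orderTop) : unitPart (single (1 : A) c * x) = x := by
  rw [unitPart, coeff_one_single_mul c hx, ← mul_assoc, single_mul_single, neg_add_cancel,
    inv_mul_cancel₀ hc, single_zero_one, one_mul]

theorem isDelta_single_mul {x : HahnSeries A ℂ} {c : ℂ} (hc : c ≠ 0)
    (hx : 0 < (x - 1).orderTop) : IsDelta (single (1 : A) c * x) := by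
  refine ⟨fun a ha => ?_, by rwa [coeff_one_single_mul c hx]⟩
  have h := orderTop_pos_iff.1 hx (a - 1) (by linarith)
  rw [coeff_sub, coeff_one, if_neg (by linarith), sub_zero] at h
  rw [coeff_single_mul, h, mul_zero]

theorem isDelta_opD : IsDelta (opD A) :=
  ⟨fun a ha => coeff_single_of_ne ha.ne, by simp [opD]⟩

theorem unitPart_opD : unitPart (opD A) = 1 := by
  simp [unitPart, opD, single_mul_single]

/-- The additive monoid generated by the exponents of `u`, where `f = f₁ D (1 + u)`. -/
def opMonoid (f : HahnSeries A ℂ) : AddSubmonoid A :=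
  AddSubmonoid.closure (unitPart f - 1).support

theorem support_unitPart_pos {f : HahnSeries A ℂ} (hf : IsDelta f) {a : A}
    (ha : a ∈ (unitPart f - 1).support) : 0 < a := by
  by_contra! h
  exact ha (orderTop_pos_iff.1 (unitPart_sub_one_orderTop_pos hf) a h)

theorem isPWO_opMonoid {f : HahnSeries A ℂ} (hf : IsDelta f) : (opMonoid f : Set A).IsPWO :=
  Set.IsPWO.addSubmonoid_closure (fun _ ha => (support_unitPart_pos hf ha).le)
    (unitPart f - 1).isPWO_support

theorem opMonoid_nonneg {f : HahnSeries A ℂ} (hf : IsDelta f) {a : A} (ha : a ∈ opMonoid f) :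
    0 ≤ a := by
  induction ha using AddSubmonoid.closure_induction with
  | mem x hx => exact (support_unitPart_pos hf hx).le
  | zero => exact le_rfl
  | add x y _ _ hx hy => exact add_nonneg hx hy

end UnitPart

variable [Algebra A ℝ]

section OpPow

/-- An exponent, as a complex number. -/
def expC (a : A) : ℂ := ((algebraMap A ℝ a : ℝ) : ℂ)

theorem expC_add (a b : A) : expC (a + b) = expC a + expC b := by simp [expC]
theorem expC_zero : expC (0 : A) = 0 := by simp [expC]
theorem expC_one : expC (1 : A) = 1 := by simp [expC]

theorem opPow_eq (f : HahnSeries A ℂ) (a : A) :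
    opPow f a = single a (f.coeff 1 ^ expC a) * onePow (unitPart f) (expC a) := rfl

theorem coeff_opPow (f : HahnSeries A ℂ) (a d : A) :
    (opPow f a).coeff d = f.coeff 1 ^ expC a * (onePow (unitPart f) (expC a)).coeff (d - a) := by
  rw [opPow_eq, coeff_single_mul]

theorem opPow_zero (f : HahnSeries A ℂ) : opPow f 0 = 1 := by
  rw [opPow_eq, expC_zero, onePow_zero, Complex.cpow_zero, single_zero_one, one_mul]

theorem opPow_one {f : HahnSeries A ℂ} (hf : IsDelta f) : opPow f 1 = f := by
  rw [opPow_eq, expC_one, Complex.cpow_one]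
  have := onePow_natCast (unitPart_sub_one_orderTop_pos hf) 1
  rw [Nat.cast_one, pow_one] at this
  rw [this, single_mul_unitPart hf.2]

theorem opPow_add {f : HahnSeries A ℂ} (hf : f.coeff 1 ≠ 0) (a b : A) :
    opPow f (a + b) = opPow f a * opPow f b := by
  rw [opPow_eq, opPow_eq, opPow_eq, expC_add, Complex.cpow_add _ _ hf, onePow_add,
    ← single_mul_single]
  ring

theorem opPow_opD (a : A) : opPow (opD A) a = single a 1 := by
  rw [opPow_eq, unitPart_opD, one_onePow, mul_one, opD, coeff_single_same, Complex.one_cpow]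

theorem sub_mem_opMonoid {f : HahnSeries A ℂ} {a d : A} (h : (opPow f a).coeff d ≠ 0) :
    d - a ∈ opMonoid f := by
  rw [coeff_opPow] at h
  exact support_onePow_subset _ _ (right_ne_zero_of_mul h)

theorem coeff_opPow_self (f : HahnSeries A ℂ) (a : A) :
    (opPow f a).coeff a = f.coeff 1 ^ expC a := by
  rw [coeff_opPow, sub_self, coeff_onePow_zero, mul_one]

theorem coeff_opPow_self_ne_zero {f : HahnSeries A ℂ} (hf : f.coeff 1 ≠ 0) (a : A) :
    (opPow f a).coeff a ≠ 0 := by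
  rw [coeff_opPow_self]
  exact fun h => hf (Complex.cpow_eq_zero_iff _ _ |>.1 h).1

theorem coeff_opPow_of_lt {f : HahnSeries A ℂ} (hf : IsDelta f) {a d : A} (h : d < a) :
    (opPow f a).coeff d = 0 := by
  by_contra hne
  have := opMonoid_nonneg hf (sub_mem_opMonoid hne)
  linarith

end OpPow

section OpComp

theorem coeff_opComp (h f : HahnSeries A ℂ) (d : A) :
    (opComp h f).coeff d = ∑ᶠ a, h.coeff a * (opPow f a).coeff d := by
  rw [opComp, coeff_hsum]
  rfl

theorem opComp_single (f : HahnSeries A ℂ) (a : A) (c : ℂ) :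
    opComp (single a c) f = c • opPow f a := by
  ext d
  rw [coeff_opComp, finsum_eq_single _ a]
  · simp
  · intro b hb
    rw [coeff_single_of_ne hb, zero_mul]

theorem opComp_opD_left {f : HahnSeries A ℂ} (hf : IsDelta f) : opComp (opD A) f = f := by
  rw [opD, opComp_single, one_smul, opPow_one hf]

theorem opComp_opD_right (h : HahnSeries A ℂ) : opComp h (opD A) = h := by
  ext d
  rw [coeff_opComp, finsum_eq_single _ d]
  · simp [opPow_opD]
  · intro b hb
    rw [opPow_opD, coeff_single_of_ne hb.symm, mul_zero]

theorem finite_sub_mem {S M : Set A} (hS : S.IsPWO) (hM : M.IsPWO) (d : A) :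
    {a ∈ S | d - a ∈ M}.Finite := by
  refine ((Set.AddAntidiagonal.finite_of_isPWO hS hM d).image Prod.fst).subset ?_
  rintro a ⟨ha, hda⟩
  exact ⟨(a, d - a), ⟨ha, hda, by simp⟩, rfl⟩

theorem finite_coeff_opPow {f : HahnSeries A ℂ} (hf : IsDelta f) {S : Set A} (hS : S.IsPWO)
    (d : A) : {a ∈ S | (opPow f a).coeff d ≠ 0}.Finite :=
  (finite_sub_mem hS (isPWO_opMonoid hf) d).subset fun _ ha => ⟨ha.1, sub_mem_opMonoid ha.2⟩

/-- Substitution commutes with infinite sums: finitely many exponents `a` of the family's joint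
support can reach `d`, and finitely many members of the family involve each such `a`. Identities
thereby reduce to monomials. -/
theorem coeff_opComp_hsum {ι : Type*} (s : SummableFamily A ℂ ι) {f : HahnSeries A ℂ}
    (hf : IsDelta f) (d : A) :
    (opComp s.hsum f).coeff d = ∑ᶠ i, (opComp (s i) f).coeff d := by
  have hfin : {x : A × ι | (s x.2).coeff x.1 * (opPow f x.1).coeff d ≠ 0}.Finite := by
    refine ((finite_coeff_opPow hf s.isPWO_iUnion_support d).biUnion
      fun a _ => (s.finite_co_support a).image (Prod.mk a)).subset ?_
    rintro ⟨a, i⟩ h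
    exact Set.mem_biUnion (x := a)
      ⟨Set.mem_iUnion.2 ⟨i, left_ne_zero_of_mul h⟩, right_ne_zero_of_mul h⟩
      ⟨i, left_ne_zero_of_mul h, rfl⟩
  simp only [coeff_opComp, coeff_hsum, finsum_mul]
  exact finsum_comm_of_finite (fun a i => (s i).coeff a * (opPow f a).coeff d) hfin

theorem hsum_termFamily (h : HahnSeries A ℂ) : (termFamily h).hsum = h := by
  ext d
  rw [coeff_hsum, finsum_eq_single _ d]
  · exact coeff_single_same _ _
  · intro b hb
    exact coeff_single_of_ne hb.symm

/-- Expanding both factors into monomials leaves `f^{a+b;0} = f^{a;0} f^{b;0}`. -/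
theorem opComp_mul (h k : HahnSeries A ℂ) {f : HahnSeries A ℂ} (hf : IsDelta f) :
    opComp (h * k) f = opComp h f * opComp k f := by
  ext d
  conv_lhs => rw [← hsum_termFamily h, ← hsum_termFamily k, ← hsum_mul, coeff_opComp_hsum _ hf]
  rw [opComp, opComp, ← hsum_mul, coeff_hsum]
  refine finsum_congr fun x => ?_
  change (opComp (single x.1 (h.coeff x.1) * single x.2 (k.coeff x.2)) f).coeff d =
    ((h.coeff x.1 • opPow f x.1) * (k.coeff x.2 • opPow f x.2)).coeff d
  rw [single_mul_single, opComp_single, opPow_add hf.2, smul_mul_smul_series]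

theorem opComp_one (f : HahnSeries A ℂ) : opComp 1 f = 1 := by
  rw [← single_zero_one, opComp_single, opPow_zero, one_smul]
  rfl

theorem opComp_smul (c : ℂ) (h f : HahnSeries A ℂ) : opComp (c • h) f = c • opComp h f := by
  ext d
  simp only [coeff_opComp, HahnSeries.coeff_smul, smul_eq_mul, mul_finsum, mul_assoc]

theorem opComp_pow (h : HahnSeries A ℂ) {f : HahnSeries A ℂ} (hf : IsDelta f) (n : ℕ) :
    opComp (h ^ n) f = opComp h f ^ n := by
  induction n with
  | zero => rw [pow_zero, pow_zero, opComp_one]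
  | succ n ih => rw [pow_succ, pow_succ, opComp_mul _ _ hf, ih]

theorem opComp_add (h k : HahnSeries A ℂ) {f : HahnSeries A ℂ} (hf : IsDelta f) :
    opComp (h + k) f = opComp h f + opComp k f := by
  ext d
  simp only [coeff_opComp, HahnSeries.coeff_add, add_mul]
  have hfin : ∀ x : HahnSeries A ℂ,
      (Function.support fun a => x.coeff a * (opPow f a).coeff d).Finite := fun x =>
    (finite_coeff_opPow hf x.isPWO_support d).subset fun a ha =>
      ⟨left_ne_zero_of_mul ha, right_ne_zero_of_mul ha⟩
  exact finsum_add_distrib (hfin h) (hfin k)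

theorem opComp_sub_one (h : HahnSeries A ℂ) {f : HahnSeries A ℂ} (hf : IsDelta f) :
    opComp (h - 1) f = opComp h f - 1 := by
  have h1 := opComp_add (h - 1) 1 hf
  rw [sub_add_cancel, opComp_one] at h1
  exact eq_sub_of_add_eq h1.symm

theorem orderTop_opComp_pos {h f : HahnSeries A ℂ} (hf : IsDelta f) (hh : 0 < h.orderTop) :
    0 < (opComp h f).orderTop := by
  refine orderTop_pos_iff.2 fun g hg => ?_
  rw [coeff_opComp]
  refine finsum_eq_zero_of_forall_eq_zero fun a => ?_
  rcases le_or_gt a 0 with ha | ha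
  · rw [orderTop_pos_iff.1 hh a ha, zero_mul]
  · rw [coeff_opPow_of_lt hf (hg.trans_lt ha), mul_zero]

/-- Substitution is additive, multiplicative and compatible with infinite sums, so it can be applied
to the binomial series term by term. -/
theorem opComp_onePow {x f : HahnSeries A ℂ} (hf : IsDelta f) (hx : 0 < (x - 1).orderTop) (s : ℂ) :
    opComp (onePow x s) f = onePow (opComp x f) s := by
  have hx' : 0 < (opComp x f - 1).orderTop := by
    rw [← opComp_sub_one _ hf]
    exact orderTop_opComp_pos hf hx
  ext d
  rw [onePow, coeff_opComp_hsum _ hf, onePow, coeff_hsum]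
  refine finsum_congr fun k => ?_
  rw [binomialFamily_apply hx, binomialFamily_apply hx', opComp_smul, opComp_pow _ hf,
    opComp_sub_one _ hf]

/-- From `f = f₁ D x` comes `f(g) = f₁ g · x(g)`, and `g = g₁ D y`. This displays the leading
coefficient and the normalization of `f(g)`. -/
theorem opComp_eq_single_mul {f g : HahnSeries A ℂ} (hf : IsDelta f) (hg : IsDelta g) :
    opComp f g = single 1 (f.coeff 1 * g.coeff 1) * (unitPart g * opComp (unitPart f) g) := by
  conv_lhs => rw [← single_mul_unitPart hf.2, opComp_mul _ _ hg, opComp_single, opPow_one hg,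
    ← single_mul_unitPart hg.2, single_mul_unitPart hg.2]
  rw [← mul_assoc]
  congr 1
  conv_lhs => rw [← single_mul_unitPart hg.2]
  rw [← C_mul_eq_smul, ← mul_assoc, C_apply, single_mul_single, zero_add]

theorem orderTop_opComp_unitPart_sub_one_pos {f g : HahnSeries A ℂ} (hf : IsDelta f)
    (hg : IsDelta g) : 0 < (opComp (unitPart f) g - 1).orderTop := by
  rw [← opComp_sub_one _ hg]
  exact orderTop_opComp_pos hg (unitPart_sub_one_orderTop_pos hf)

theorem orderTop_unitPart_mul_sub_one_pos {f g : HahnSeries A ℂ} (hf : IsDelta f)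
    (hg : IsDelta g) : 0 < (unitPart g * opComp (unitPart f) g - 1).orderTop :=
  orderTop_mul_sub_one_pos (unitPart_sub_one_orderTop_pos hg)
    (orderTop_opComp_unitPart_sub_one_pos hf hg)

theorem isDelta_opComp {f g : HahnSeries A ℂ} (hf : IsDelta f) (hg : IsDelta g) :
    IsDelta (opComp f g) := by
  rw [opComp_eq_single_mul hf hg]
  exact isDelta_single_mul (mul_ne_zero hf.2 hg.2) (orderTop_unitPart_mul_sub_one_pos hf hg)

theorem coeff_one_opComp {f g : HahnSeries A ℂ} (hf : IsDelta f) (hg : IsDelta g) :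
    (opComp f g).coeff 1 = f.coeff 1 * g.coeff 1 := by
  rw [opComp_eq_single_mul hf hg]
  exact coeff_one_single_mul _ (orderTop_unitPart_mul_sub_one_pos hf hg)

/-- The power law `f(g)^{a;0} = f^{a;0}(g)`. -/
theorem opPow_opComp {f g : HahnSeries A ℂ} (hf : IsDelta f) (hg : IsDelta g) (a : A)
    (hmul : (f.coeff 1 * g.coeff 1) ^ expC a = f.coeff 1 ^ expC a * g.coeff 1 ^ expC a) :
    opPow (opComp f g) a = opComp (opPow f a) g := by
  have hu := unitPart_sub_one_orderTop_pos hf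
  have hv := unitPart_sub_one_orderTop_pos hg
  rw [opPow_eq f, opComp_mul _ _ hg, opComp_single, opComp_onePow hg hu, opPow_eq g,
    opPow_eq, coeff_one_opComp hf hg, hmul, opComp_eq_single_mul hf hg,
    unitPart_single_mul (mul_ne_zero hf.2 hg.2) (orderTop_unitPart_mul_sub_one_pos hf hg),
    mul_onePow hv (orderTop_opComp_unitPart_sub_one_pos hf hg), ← C_mul_eq_smul, C_apply,
    ← mul_assoc, ← mul_assoc, single_mul_single, zero_add]

end OpComp

end Operators

/-! ### The group of delta operators -/

section Composition

variable {A : Type} [CommRing A] [LinearOrder A] [IsStrictOrderedRing A] [Algebra A ℝ]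

section Inverse

/-- Sets of leading coefficients on which the principal powers are multiplicative. -/
structure IsPowerGroup (A : Type) [CommRing A] [Algebra A ℝ] (K : Set ℂ) : Prop where
  ne_zero : ∀ c ∈ K, c ≠ 0
  one_mem : 1 ∈ K
  mul_mem : ∀ c ∈ K, ∀ d ∈ K, c * d ∈ K
  inv_mem : ∀ c ∈ K, c⁻¹ ∈ K
  mul_cpow : ∀ c ∈ K, ∀ d ∈ K, ∀ a : A, (c * d) ^ expC a = c ^ expC a * d ^ expC a

/-- The delta operators with leading coefficient in `K`. -/
def IsDeltaIn (K : Set ℂ) (f : HahnSeries A ℂ) : Prop :=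
  (∀ a < 1, f.coeff a = 0) ∧ f.coeff 1 ∈ K

variable {K : Set ℂ}

theorem IsDeltaIn.isDelta {f : HahnSeries A ℂ} (hf : IsDeltaIn K f) (hK : IsPowerGroup A K) :
    IsDelta f := ⟨hf.1, hK.ne_zero _ hf.2⟩

theorem isDeltaIn_opD (hK : IsPowerGroup A K) : IsDeltaIn K (opD A) :=
  ⟨isDelta_opD.1, by simpa [opD] using hK.one_mem⟩

theorem IsDeltaIn.opComp (hK : IsPowerGroup A K) {f g : HahnSeries A ℂ} (hf : IsDeltaIn K f)
    (hg : IsDeltaIn K g) : IsDeltaIn K (opComp f g) := by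
  refine ⟨(isDelta_opComp (hf.isDelta hK) (hg.isDelta hK)).1, ?_⟩
  rw [coeff_one_opComp (hf.isDelta hK) (hg.isDelta hK)]
  exact hK.mul_mem _ hf.2 _ hg.2

theorem opPow_opComp_of_mem (hK : IsPowerGroup A K) {f g : HahnSeries A ℂ} (hf : IsDeltaIn K f)
    (hg : IsDeltaIn K g) (a : A) : opPow (opComp f g) a = opComp (opPow f a) g :=
  opPow_opComp (hf.isDelta hK) (hg.isDelta hK) a (hK.mul_cpow _ hf.2 _ hg.2 a)

/-- Substituting `g` into `∑ h_a f^{a;0}` term by term and applying the power law gives `∑ h_a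
f(g)^{a;0}`. -/
theorem opComp_assoc (hK : IsPowerGroup A K) (h : HahnSeries A ℂ) {f g : HahnSeries A ℂ}
    (hf : IsDeltaIn K f) (hg : IsDeltaIn K g) :
    opComp (opComp h f) g = opComp h (opComp f g) := by
  ext d
  change (IterLog.opComp (compFamily h f).hsum g).coeff d = _
  rw [coeff_opComp_hsum _ (hg.isDelta hK), coeff_opComp]
  refine finsum_congr fun a => ?_
  rw [opPow_opComp_of_mem hK hf hg, ← smul_eq_mul, ← HahnSeries.coeff_smul, ← opComp_smul]
  rfl

/-- Every delta operator has a left inverse under composition. -/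
theorem exists_left_inverse {f : HahnSeries A ℂ} (hf : IsDelta f) :
    ∃ e : HahnSeries A ℂ, (∀ a < 1, e.coeff a = 0) ∧ e.coeff 1 = (f.coeff 1)⁻¹ ∧
      opComp e f = opD A := by
  classical
  -- The exponents `1 + M`, with `M` generated by the exponents of the tail of `f`, are the only
  -- ones needed. They are well-ordered, so the triangular system `∑_b e_b [D^d] f^{b;0} = δ_{d1}`
  -- is solvable by recursion on `d`.
  set S : Set A := {a | a - 1 ∈ opMonoid f} with hS
  have hSP : S.IsPWO := by
    refine ((isPWO_opMonoid hf).image_of_monotone (f := fun a => a + 1)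
      (fun a b h => by simpa using h)).mono fun a ha => ⟨a - 1, ha, by simp⟩
  have hS1 : ∀ a ∈ S, 1 ≤ a := fun a ha => by
    have := opMonoid_nonneg hf ha
    linarith
  have h1S : (1 : A) ∈ S := by
    rw [hS, Set.mem_ofPred_eq, sub_self]
    exact zero_mem _
  have hwf : WellFounded fun a b : S => (a : A) < b := hSP.isWF
  -- the coefficients of the inverse, by recursion over `S`
  obtain ⟨e, he⟩ : ∃ e : S → ℂ, ∀ d : S, e d = ((opPow f (d : A)).coeff d)⁻¹ *
      ((if (d : A) = 1 then 1 else 0) -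
        ∑ᶠ b : S, if (b : A) < d then e b * (opPow f (b : A)).coeff d else 0) := by
    refine ⟨hwf.fix fun d rec => ((opPow f (d : A)).coeff d)⁻¹ *
      ((if (d : A) = 1 then 1 else 0) -
        ∑ᶠ b : S, if h : (b : A) < d then rec b h * (opPow f (b : A)).coeff d else 0), fun d => ?_⟩
    rw [hwf.fix_eq]
    simp only [dite_eq_ite]
  let E : A → ℂ := fun a => if h : a ∈ S then e ⟨a, h⟩ else 0
  have hE : ∀ a ∉ S, E a = 0 := fun a ha => dif_neg ha
  have hES : ∀ a : S, E a = e a := fun a => dif_pos a.2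
  let H : HahnSeries A ℂ := ⟨E, hSP.mono fun a ha => by
    by_contra h
    exact ha (hE a h)⟩
  have hH : ∀ a, H.coeff a = E a := fun _ => rfl
  have hcomp : opComp H f = opD A := by
    ext d
    rw [coeff_opComp, opD]
    by_cases hd : d ∈ S
    · have hdd := coeff_opPow_self_ne_zero hf.2 d
      have hfin : (Function.support fun b => if b < d then E b * (opPow f b).coeff d else 0).Finite := by
        refine (finite_coeff_opPow hf hSP d).subset fun b hb => ?_
        rw [Function.mem_support] at hb
        split_ifs at hb with hbd
        · exact ⟨by_contra fun h => left_ne_zero_of_mul hb (hE b h), right_ne_zero_of_mul hb⟩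
        · exact absurd rfl hb
      -- Powers with `b > d` do not reach `d`: the recursion handles `b < d`, and the diagonal term
      -- is invertible.
      have hsplit : ∀ b, H.coeff b * (opPow f b).coeff d =
          (if b < d then E b * (opPow f b).coeff d else 0) +
            (if b = d then E d * (opPow f d).coeff d else 0) := by
        intro b
        rcases lt_trichotomy b d with h | rfl | h
        · simp [h, h.ne, hH]
        · simp [hH]
        · simp [h.not_gt, h.ne', coeff_opPow_of_lt hf h]
      have hsub : ∑ᶠ b : A, (if b < d then E b * (opPow f b).coeff d else 0) =
          ∑ᶠ b : S, if (b : A) < d then e b * (opPow f (b : A)).coeff d else 0 := by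
        rw [← finsum_mem_univ, ← finsum_mem_inter_support_eq' _ S Set.univ,
          ← finsum_set_coe_eq_finsum_mem]
        · exact finsum_congr fun b => by rw [hES]
        · intro b hb
          refine ⟨fun _ => trivial, fun _ => by_contra fun h => hb ?_⟩
          simp [hE b h]
      have hed := he ⟨d, hd⟩
      rw [finsum_congr hsplit, finsum_add_distrib hfin
        ((Set.finite_singleton d).subset fun b hb => by
          by_contra h
          exact hb (if_neg h)), hsub,
        finsum_eq_single (fun b => if b = d then E d * (opPow f d).coeff d else 0) d
          fun b hb => if_neg hb, if_pos rfl, hES ⟨d, hd⟩, hed, coeff_single]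
      rw [mul_right_comm, inv_mul_cancel₀ hdd, one_mul, add_sub_cancel]
      split_ifs <;> rfl
    -- Outside `S` no term contributes: `b - 1 ∈ M` and `d - b ∈ M` would force `d - 1 ∈ M`.
    · have hd1 : d ≠ 1 := fun h => hd (h ▸ h1S)
      rw [coeff_single_of_ne hd1]
      refine finsum_eq_zero_of_forall_eq_zero fun b => ?_
      by_contra hne
      refine hd ?_
      have hb : b ∈ S := by_contra fun h => left_ne_zero_of_mul hne (hE b h)
      have := add_mem hb (sub_mem_opMonoid (right_ne_zero_of_mul hne))
      rwa [sub_add_sub_comm, add_comm b d, add_sub_add_right_eq_sub] at this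
  refine ⟨H, fun a ha => hE a fun h => (hS1 a h).not_gt ha, ?_, hcomp⟩
  rw [hH, hES ⟨1, h1S⟩, he, finsum_eq_zero_of_forall_eq_zero, opPow_one hf]
  · simp
  · intro b
    exact if_neg (hS1 _ b.2).not_gt

/-- The group of the delta operators with leading coefficient in `K`. -/
@[reducible]
def deltaGroup (hK : IsPowerGroup A K) : Group {f : HahnSeries A ℂ // IsDeltaIn K f} :=
  letI : Mul {f : HahnSeries A ℂ // IsDeltaIn K f} :=
    ⟨fun f g => ⟨opComp f.1 g.1, f.2.opComp hK g.2⟩⟩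
  letI : One {f : HahnSeries A ℂ // IsDeltaIn K f} := ⟨⟨opD A, isDeltaIn_opD hK⟩⟩
  letI : Inv {f : HahnSeries A ℂ // IsDeltaIn K f} :=
    ⟨fun f => ⟨(exists_left_inverse (f.2.isDelta hK)).choose,
      (exists_left_inverse (f.2.isDelta hK)).choose_spec.1, by
        rw [(exists_left_inverse (f.2.isDelta hK)).choose_spec.2.1]
        exact hK.inv_mem _ f.2.2⟩⟩
  -- A left identity and left inverses suffice; that the inverses are two-sided is then a fact of
  -- group theory.
  Group.ofLeftAxioms (fun f g h => Subtype.ext (opComp_assoc hK f.1 g.2 h.2))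
    (fun f => Subtype.ext (opComp_opD_left (f.2.isDelta hK)))
    (fun f => Subtype.ext (exists_left_inverse (f.2.isDelta hK)).choose_spec.2.2)

end Inverse

end Composition

/-! ### Augmentation and power sequences -/

section Sequences

theorem romanFactorial_ne_zero (a : ℝ) : romanFactorial a ≠ 0 := by
  rw [romanFactorial]
  split_ifs with h
  · exact div_ne_zero (pow_ne_zero _ (by norm_num)) (by exact_mod_cast Nat.factorial_ne_zero _)
  · refine Real.Gamma_ne_zero fun m hm => h ?_
    have ha : -a - 1 = m := by linarith
    rw [ha, Nat.floor_natCast]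
    linarith

theorem romanFactorial_zero : romanFactorial 0 = 1 := by
  rw [romanFactorial, if_neg]
  · simp
  · have : (0 : ℝ) ≤ ⌊-(0 : ℝ) - 1⌋₊ := by positivity
    intro h
    linarith

variable {A : Type} [CommRing A] [LinearOrder A] [IsStrictOrderedRing A]

open scoped Pointwise

/-- Negation turns the ascending chain condition into partial well-order, to which the results on
sums of well-ordered sets apply. -/
theorem wellFoundedOn_gt_iff {S : Set A} : S.WellFoundedOn (· > ·) ↔ (-S).IsPWO := by
  rw [Set.isPWO_iff_isWF, Set.IsWF, ← Set.image_neg_eq_neg,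
    Set.wellFoundedOn_image]
  exact iff_of_eq (congrArg _ (funext₂ fun a b => propext neg_lt_neg_iff.symm))

theorem finite_neg_mem {S T : Set A} (hS : S.IsPWO) (hT : T.IsPWO) : {a ∈ S | -a ∈ T}.Finite := by
  refine ((Set.AddAntidiagonal.finite_of_isPWO hS hT 0).image Prod.fst).subset ?_
  rintro a ⟨ha, hda⟩
  exact ⟨(a, -a), ⟨ha, hda, by simp⟩, rfl⟩

theorem finite_inter_of_isPWO {S T : Set A} (hS : S.WellFoundedOn (· > ·)) (hT : T.IsPWO) :
    (S ∩ T).Finite := by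
  refine (finite_neg_mem hT (wellFoundedOn_gt_iff.1 hS)).subset fun a ha => ⟨ha.2, ?_⟩
  simpa using ha.1

variable [Algebra A ℝ] {K : Set ℂ}

/-- The Roman factorial of an exponent, as a complex number. -/
def romC (a : A) : ℂ := (romanFactorial (algebraMap A ℝ a) : ℂ)

theorem romC_ne_zero (a : A) : romC a ≠ 0 :=
  Complex.ofReal_ne_zero.2 (romanFactorial_ne_zero _)

theorem augment_eq (h : HahnSeries A ℂ) (p : GradedSequence A) (a : A) :
    augment h p a = ∑ᶠ d, h.coeff d * (romC d * p.coeff a d) := by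
  rw [augment, opAct]
  refine finsum_congr fun d => ?_
  rw [sub_zero, map_zero, romanFactorial_zero, div_one, mul_assoc]
  rfl

theorem augment_single (d : A) (c : ℂ) (p : GradedSequence A) (a : A) :
    augment (single d c) p a = c * (romC d * p.coeff a d) := by
  rw [augment_eq, finsum_eq_single _ d]
  · rw [coeff_single_same]
  · intro b hb
    rw [coeff_single_of_ne hb, zero_mul]

theorem wellFoundedOn_row (p : GradedSequence A) (a : A) :
    {d | p.coeff a d ≠ 0}.WellFoundedOn (· > ·) :=
  (p.noetherian {a} (Set.wellFoundedOn_singleton)).subset fun _ hd => ⟨a, rfl, hd⟩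

/-- A row of `p` satisfies the ascending chain condition and the family has well-ordered joint
support; they meet in a finite set, so the sums can be exchanged. -/
theorem augment_hsum {ι : Type*} (s : SummableFamily A ℂ ι) (p : GradedSequence A) (a : A) :
    augment s.hsum p a = ∑ᶠ i, augment (s i) p a := by
  have hfin : {x : A × ι | (s x.2).coeff x.1 * (romC x.1 * p.coeff a x.1) ≠ 0}.Finite := by
    refine ((finite_inter_of_isPWO (wellFoundedOn_row p a) s.isPWO_iUnion_support).biUnion
      fun d _ => (s.finite_co_support d).image (Prod.mk d)).subset ?_
    rintro ⟨d, i⟩ h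
    exact Set.mem_biUnion (x := d) ⟨right_ne_zero_of_mul (right_ne_zero_of_mul h),
      Set.mem_iUnion.2 ⟨i, left_ne_zero_of_mul h⟩⟩ ⟨i, left_ne_zero_of_mul h, rfl⟩
  simp only [augment_eq, coeff_hsum, finsum_mul]
  exact finsum_comm_of_finite (fun d i => (s i).coeff d * (romC d * p.coeff a d)) hfin

theorem augment_smul (c : ℂ) (h : HahnSeries A ℂ) (p : GradedSequence A) (a : A) :
    augment (c • h) p a = c * augment h p a := by
  simp only [augment_eq, HahnSeries.coeff_smul, smul_eq_mul, mul_finsum, mul_assoc]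

/-- The graded sequence with coefficients `⌊a⌉! / ⌊d⌉! · [D^a] e(D)^{d;0}`. -/
def powerSequence (e : HahnSeries A ℂ) (he : IsDelta e) : GradedSequence A where
  coeff a d := romC a / romC d * (opPow e d).coeff a
  coeff_of_lt a d h := by rw [coeff_opPow_of_lt he h, mul_zero]
  coeff_self a := mul_ne_zero (div_ne_zero (romC_ne_zero a) (romC_ne_zero a))
    (coeff_opPow_self_ne_zero he.2 a)
  noetherian S hS := by
    rw [wellFoundedOn_gt_iff] at hS ⊢
    -- If `c_{ab} ≠ 0` then `-b = (a - b) + (-a)`, where `a - b` lies in the exponent monoid of `e`.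
    refine ((isPWO_opMonoid he).add hS).mono ?_
    rintro d ⟨a, ha, hda⟩
    have := sub_mem_opMonoid (right_ne_zero_of_mul hda)
    exact ⟨a - -d, this, -a, by simpa using ha, by ring⟩
  finite S hS d := (finite_inter_of_isPWO hS (opPow e d).isPWO_support).subset
    fun _ ha => ⟨ha.1, right_ne_zero_of_mul ha.2⟩

theorem coeff_powerSequence (e : HahnSeries A ℂ) (he : IsDelta e) (a d : A) :
    (powerSequence e he).coeff a d = romC a / romC d * (opPow e d).coeff a := rfl

/-- The central formula: the factor `⌊d⌉!` from the action of `D^d` cancels the denominator of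
`c_{ad}`, leaving the sum that defines `h(e)`. -/
theorem augment_powerSequence (h : HahnSeries A ℂ) {e : HahnSeries A ℂ} (he : IsDelta e) (a : A) :
    augment h (powerSequence e he) a = romC a * (opComp h e).coeff a := by
  rw [augment_eq, coeff_opComp, mul_finsum]
  refine finsum_congr fun d => ?_
  rw [coeff_powerSequence]
  field_simp [romC_ne_zero d]

/-- The column `d = 1` contains the coefficients of `e^{1;0} = e`, up to nonzero factors. -/
theorem powerSequence_injective {e e' : HahnSeries A ℂ} (he : IsDelta e) (he' : IsDelta e')
    (h : powerSequence e he = powerSequence e' he') : e = e' := by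
  ext a
  have h1 := congrFun (congrFun (congrArg GradedSequence.coeff h) a) 1
  rw [coeff_powerSequence, coeff_powerSequence, opPow_one he, opPow_one he'] at h1
  exact mul_left_cancel₀ (div_ne_zero (romC_ne_zero a) (romC_ne_zero 1)) h1

theorem powerSequence_opD : powerSequence (opD A) isDelta_opD = GradedSequence.harmonic A := by
  ext a d
  rw [coeff_powerSequence, opPow_opD, coeff_single]
  change _ = if a = d then (1 : ℂ) else 0
  split_ifs with h
  · rw [h, div_self (romC_ne_zero d), mul_one]
  · rw [mul_zero]

/-- The intermediate factorials cancel, and the sum over `b` is the expansion of `e'^{d;0}(e)`, a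
power of `e'(e)` by the power law. The order is reversed. -/
theorem umbral_powerSequence (hK : IsPowerGroup A K) {e e' : HahnSeries A ℂ} (he : IsDeltaIn K e)
    (he' : IsDeltaIn K e') :
    (powerSequence e (he.isDelta hK)).umbral (powerSequence e' (he'.isDelta hK)) =
      powerSequence (opComp e' e) ((he'.opComp hK he).isDelta hK) := by
  ext a d
  rw [coeff_powerSequence, opPow_opComp_of_mem hK he' he, coeff_opComp, mul_finsum]
  refine finsum_congr fun b => ?_
  rw [coeff_powerSequence, coeff_powerSequence]
  field_simp [romC_ne_zero b]

/-- By the power law `f^{b;0}(e) = f(e)^{b;0} = D^b`. -/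
theorem isAssociated_powerSequence (hK : IsPowerGroup A K) {f e : HahnSeries A ℂ}
    (hf : IsDeltaIn K f) (he : IsDeltaIn K e) (hfe : opComp f e = opD A) :
    IsAssociated f (powerSequence e (he.isDelta hK)) := by
  intro a b
  rw [augment_powerSequence, ← opPow_opComp_of_mem hK hf he, hfe, opPow_opD, coeff_single]
  split_ifs
  · exact mul_one _
  · exact mul_zero _

/-- Since `(h(e))(f) = h`, every `h` equals `∑_b [D^b] h(e) · f^{b;0}`, so association determines
all augmentations of `p`; the choice `h = D^d` recovers its coefficients. -/
theorem eq_powerSequence_of_isAssociated (hK : IsPowerGroup A K) {f e : HahnSeries A ℂ}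
    (hf : IsDeltaIn K f) (he : IsDeltaIn K e) (hef : opComp e f = opD A) {p : GradedSequence A}
    (hp : IsAssociated f p) : p = powerSequence e (he.isDelta hK) := by
  have key : ∀ (h : HahnSeries A ℂ) (a : A),
      augment h p a = romC a * (opComp h e).coeff a := by
    intro h a
    have hh : (compFamily (opComp h e) f).hsum = h := by
      change opComp (opComp h e) f = h
      rw [opComp_assoc hK h he hf, hef, opComp_opD_right]
    conv_lhs => rw [← hh, augment_hsum]
    rw [finsum_eq_single _ a]
    · change augment ((opComp h e).coeff a • opPow f a) p a = _
      rw [augment_smul, hp, if_pos rfl, mul_comm]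
      rfl
    · intro b hb
      change augment ((opComp h e).coeff b • opPow f b) p a = _
      rw [augment_smul, hp, if_neg hb.symm, mul_zero]
  ext a d
  have hd := key (single d 1) a
  rw [augment_single, opComp_single, one_smul, one_mul] at hd
  rw [coeff_powerSequence, div_mul_eq_mul_div, ← hd, mul_div_cancel_left₀ _ (romC_ne_zero d)]

theorem coeff_mul_eq_finsum (x y : HahnSeries A ℂ) (a : A) :
    (x * y).coeff a = ∑ᶠ b, x.coeff b * y.coeff (a - b) := by
  rw [coeff_mul, finsum_eq_sum_of_support_subset
    (s := (Finset.antidiagonal x.isPWO_support y.isPWO_support a).image Prod.fst)]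
  · rw [Finset.sum_image]
    · refine Finset.sum_congr rfl fun ij hij => ?_
      rw [Finset.mem_antidiagonal] at hij
      rw [← hij.2.2, add_sub_cancel_left]
    · intro i hi j hj h
      rw [Finset.mem_coe, Finset.mem_antidiagonal] at hi hj
      have h1 : i.1 = j.1 := h
      have h2 := hi.2.2.trans hj.2.2.symm
      rw [h1] at h2
      exact Prod.ext h1 (add_left_cancel h2)
  · intro b hb
    rw [Finset.coe_image]
    exact ⟨(b, a - b), by
      rw [Finset.mem_coe, Finset.mem_antidiagonal]
      exact ⟨left_ne_zero_of_mul hb, right_ne_zero_of_mul hb, by ring⟩, rfl⟩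

/-- Divided by `⌊a⌉!`, the Roman identity is the Cauchy product formula for `(fg)(e) = f(e) g(e)`.
-/
theorem isRoman_powerSequence {e : HahnSeries A ℂ} (he : IsDelta e) :
    IsRoman (powerSequence e he) := by
  intro f g a
  simp only [augment_powerSequence]
  constructor
  · refine (finite_sub_mem (opComp f e).isPWO_support (opComp g e).isPWO_support a).subset ?_
    intro b hb
    exact ⟨right_ne_zero_of_mul (left_ne_zero_of_mul hb),
      right_ne_zero_of_mul (right_ne_zero_of_mul hb)⟩
  · rw [opComp_mul _ _ he, coeff_mul_eq_finsum, mul_finsum]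
    refine finsum_congr fun b => ?_
    have hc : (romanCoeff (algebraMap A ℝ a) (algebraMap A ℝ b) : ℂ) =
        romC a / (romC b * romC (a - b)) := by
      simp [romanCoeff, romC]
    rw [hc]
    field_simp [romC_ne_zero b, romC_ne_zero (a - b)]

end Sequences

/-! ### Linear independence of the harmonic logarithms -/

section HarmonicLog

theorem stirlingCoeff_zero (a : ℝ) : stirlingCoeff a 0 = (Complex.Gamma ((a : ℂ) + 1))⁻¹ := by
  simp [stirlingCoeff]

/-- Induction via `1/Γ(z) = z/Γ(z+1)`: because `1/Γ(-n) = 0`, the product rule just multiplies the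
derivative by `-(n+1)`. -/
theorem hasDerivAt_Gamma_div_Gamma (n : ℕ) :
    HasDerivAt (fun s : ℂ => Complex.Gamma (1 + s) * (Complex.Gamma (s - n))⁻¹)
      ((-1) ^ n * (n ! : ℂ)) 0 := by
  induction n with
  | zero =>
    have h : (fun s : ℂ => Complex.Gamma (1 + s) * (Complex.Gamma (s - (0 : ℕ)))⁻¹) =ᶠ[nhds 0]
        fun s => s := by
      have hU : ∀ᶠ s : ℂ in nhds 0, -1 < s.re :=
        Complex.continuous_re.continuousAt.eventually (lt_mem_nhds (by norm_num))
      filter_upwards [hU] with s hs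
      have hne : Complex.Gamma (s + 1) ≠ 0 :=
        Complex.Gamma_ne_zero_of_re_pos (by simpa using by linarith)
      rw [Nat.cast_zero, sub_zero, Complex.one_div_Gamma_eq_self_mul_one_div_Gamma_add_one,
        add_comm 1 s]
      field_simp
    simpa using (hasDerivAt_id (0 : ℂ)).congr_of_eventuallyEq h
  | succ n ih =>
    have h : (fun s : ℂ => Complex.Gamma (1 + s) * (Complex.Gamma (s - (n + 1 : ℕ)))⁻¹) =
        fun s => (s - (n + 1 : ℕ)) * (Complex.Gamma (1 + s) * (Complex.Gamma (s - n))⁻¹) := by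
      funext s
      rw [Complex.one_div_Gamma_eq_self_mul_one_div_Gamma_add_one]
      have : s - ((n + 1 : ℕ) : ℂ) + 1 = s - n := by push_cast; ring
      rw [this]
      ring
    have hlin : HasDerivAt (fun s : ℂ => s - ((n + 1 : ℕ) : ℂ)) 1 0 :=
      (hasDerivAt_id (0 : ℂ)).sub_const _
    have h0 : Complex.Gamma (0 - (n : ℂ)) = 0 := by
      rw [zero_sub]
      exact Complex.Gamma_neg_nat_eq_zero n
    rw [h]
    refine (hlin.mul ih).congr_deriv ?_
    rw [h0, Nat.factorial_succ]
    push_cast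
    ring

theorem stirlingCoeff_one_ne_zero (n : ℕ) : stirlingCoeff (-(n + 1)) 1 ≠ 0 := by
  have hf : (fun s : ℂ => Complex.Gamma (1 + s) / Complex.Gamma (((-(n + 1) : ℝ) : ℂ) + 1 + s)) =
      fun s : ℂ => Complex.Gamma (1 + s) * (Complex.Gamma (s - n))⁻¹ := by
    funext s
    rw [div_eq_mul_inv]
    congr 3
    push_cast
    ring
  rw [stirlingCoeff, hf, iteratedDeriv_one, (hasDerivAt_Gamma_div_Gamma n).deriv]
  simp [Nat.factorial_ne_zero]

/-- The zeroth coefficient is `1/Γ(a+1)`; it vanishes only at negative integers `a`, where `1/Γ` has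
a simple zero and the first coefficient survives. -/
theorem stirlingCoeff_zero_or_one_ne_zero (a : ℝ) :
    stirlingCoeff a 0 ≠ 0 ∨ stirlingCoeff a 1 ≠ 0 := by
  by_cases h : ∃ m : ℕ, (a : ℂ) + 1 = -m
  · obtain ⟨m, hm⟩ := h
    have ha : a = -(m + 1) := by
      have : a + 1 = -m := by exact_mod_cast hm
      linarith
    exact Or.inr (ha ▸ stirlingCoeff_one_ne_zero m)
  · push Not at h
    left
    rw [stirlingCoeff_zero]
    exact inv_ne_zero (Complex.Gamma_ne_zero h)

/-- The exponent of the monomial `log x`. -/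
def logX : LogExp := Finsupp.single 0 1

theorem logDeriv_logX : logDeriv (Finsupp.single logX 1) = Finsupp.single 0 1 := by
  simp [logDeriv, logX]

theorem logDeriv_zero : logDeriv (Finsupp.single 0 1) = 0 := by
  simp [logDeriv]

theorem logDeriv_pow_logX (k : ℕ) : (logDeriv ^ (k + 2)) (Finsupp.single logX 1) = 0 := by
  rw [_root_.pow_add, pow_two, Module.End.mul_apply, Module.End.mul_apply, logDeriv_logX, logDeriv_zero,
    map_zero]

theorem finsum_logDeriv_logX (c : ℕ → ℂ) (β : LogExp) :
    ∑ᶠ k, c k * (logDeriv ^ k) (Finsupp.single logX 1) β =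
      c 0 * (Finsupp.single logX (1 : ℂ) : LogExp →₀ ℂ) β +
        c 1 * (Finsupp.single (0 : LogExp) (1 : ℂ) : LogExp →₀ ℂ) β := by
  rw [finsum_eq_sum_of_support_subset (s := Finset.range 2)]
  · simp [Finset.sum_range_succ, logDeriv_logX]
  · intro k hk
    by_contra hk'
    obtain ⟨j, rfl⟩ := Nat.exists_eq_add_of_le' (show 2 ≤ k by simp at hk'; omega)
    exact hk (by simp [logDeriv_pow_logX])

variable {A : Type} [CommRing A] [LinearOrder A] [IsStrictOrderedRing A] [Algebra A ℝ]

theorem harmonicLog_of_ne {a b : A} (h : b ≠ a) (α β : LogExp) : harmonicLog a α b β = 0 :=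
  if_neg h

/-- The choice `ℓ^α = log x` matters, since `λ_a^(0)` is zero for negative integers `a`. Here the
monomials `log x` and `1` carry the Stirling coefficients of index `0` and `1`. -/
theorem exists_harmonicLog_ne_zero (a : A) : ∃ β, harmonicLog a logX a β ≠ 0 := by
  have hβ : ∀ β, harmonicLog a logX a β = (romanFactorial (algebraMap A ℝ a) : ℂ) *
      (stirlingCoeff (algebraMap A ℝ a) 0 * (Finsupp.single logX (1 : ℂ) : LogExp →₀ ℂ) β +
        stirlingCoeff (algebraMap A ℝ a) 1 *
          (Finsupp.single (0 : LogExp) (1 : ℂ) : LogExp →₀ ℂ) β) := fun β => by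
    rw [harmonicLog, if_pos rfl, finsum_logDeriv_logX]
  have hne : logX ≠ 0 := by simp [logX]
  rcases stirlingCoeff_zero_or_one_ne_zero (algebraMap A ℝ a) with h | h
  · refine ⟨logX, ?_⟩
    rw [hβ]
    simpa [hne.symm, hne, h] using romanFactorial_ne_zero (algebraMap A ℝ a)
  · refine ⟨0, ?_⟩
    rw [hβ]
    simpa [hne.symm, hne, h] using romanFactorial_ne_zero (algebraMap A ℝ a)

theorem series_apply (p : GradedSequence A) (a : A) (α : LogExp) (b : A) (β : LogExp) :
    p.series a α b β = p.coeff a b * harmonicLog b α b β := by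
  rw [GradedSequence.series, finsum_eq_single _ b]
  intro d hd
  rw [harmonicLog_of_ne hd.symm, mul_zero]

theorem series_harmonic (a : A) (α : LogExp) :
    (GradedSequence.harmonic A).series a α = harmonicLog a α := by
  funext b β
  rw [series_apply]
  change (if a = b then (1 : ℂ) else 0) * _ = _
  split_ifs with h
  · rw [h, one_mul]
  · rw [zero_mul, harmonicLog_of_ne (Ne.symm h)]

/-- The harmonic logarithms are linearly independent: a graded sequence is determined by its
series. -/
theorem series_eq_harmonicLog_iff (p : GradedSequence A) :
    (∀ (a : A) (α : LogExp), p.series a α = harmonicLog a α) ↔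
      p = GradedSequence.harmonic A := by
  constructor
  · intro h
    ext a b
    obtain ⟨β, hβ⟩ := exists_harmonicLog_ne_zero b
    have h1 := congrFun (congrFun (h a logX) b) β
    rw [← series_harmonic, series_apply, series_apply] at h1
    exact mul_right_cancel₀ hβ h1
  · rintro rfl a α
    exact series_harmonic a α

end HarmonicLog

/-! ### Roman sequences with integer exponents are power sequences -/

section DiscreteRoman

theorem isPowerGroup_ne_zero : IsPowerGroup ℤ {c : ℂ | c ≠ 0} where
  ne_zero _ hc := hc
  one_mem := one_ne_zero
  mul_mem _ hc _ hd := mul_ne_zero hc hd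
  inv_mem _ hc := inv_ne_zero hc
  mul_cpow c _ d _ a := by
    have h : expC a = (a : ℂ) := by simp [expC]
    rw [h, Complex.cpow_intCast, Complex.cpow_intCast, Complex.cpow_intCast, mul_zpow]

theorem isPowerGroup_pos : IsPowerGroup ℝ {c : ℂ | ∃ r : ℝ, 0 < r ∧ c = r} where
  ne_zero := by
    rintro _ ⟨r, hr, rfl⟩
    exact_mod_cast hr.ne'
  one_mem := ⟨1, one_pos, by simp⟩
  mul_mem := by
    rintro _ ⟨r, hr, rfl⟩ _ ⟨t, ht, rfl⟩
    exact ⟨r * t, mul_pos hr ht, by simp⟩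
  inv_mem := by
    rintro _ ⟨r, hr, rfl⟩
    exact ⟨r⁻¹, inv_pos.2 hr, by simp⟩
  mul_cpow := by
    rintro _ ⟨r, hr, rfl⟩ _ ⟨t, ht, rfl⟩ a
    exact Complex.mul_cpow_ofReal_nonneg hr.le ht.le _

/-- As `p_a` has no terms above degree `a`, the augmentations vanish below the order of `h`. Over
`ℤ`, being bounded below already implies well-order. -/
theorem coeff_romanSeries_isPWO (p : GradedSequence ℤ) (h : HahnSeries ℤ ℂ) :
    (Function.support fun a => augment h p a / romC a).IsPWO := by
  have hsub : (Function.support fun a => augment h p a / romC a) ⊆ Set.Ici h.order := by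
    intro a ha
    have h1 : augment h p a ≠ 0 := fun h0 => ha (by simp [h0])
    rw [augment_eq] at h1
    obtain ⟨d, hd⟩ := exists_ne_zero_of_finsum h1
    have hd1 := order_le_of_coeff_ne_zero (left_ne_zero_of_mul hd)
    refine hd1.trans (not_lt.1 fun hlt => ?_)
    exact right_ne_zero_of_mul (right_ne_zero_of_mul hd) (p.coeff_of_lt a d hlt)
  exact (Set.isPWO_iff_isWF.2 (BddBelow.isWF ⟨h.order, fun a ha => ha⟩)).mono hsub

/-- The series `∑ₐ ⟨h(D) p_a⟩ / ⌊a⌉! · D^a`. -/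
def romanSeries (p : GradedSequence ℤ) (h : HahnSeries ℤ ℂ) : HahnSeries ℤ ℂ :=
  ⟨fun a => augment h p a / romC a, coeff_romanSeries_isPWO p h⟩

theorem coeff_romanSeries (p : GradedSequence ℤ) (h : HahnSeries ℤ ℂ) (a : ℤ) :
    (romanSeries p h).coeff a = augment h p a / romC a := rfl

/-- The Roman coefficient is exactly what turns the Roman identity into a Cauchy product. -/
theorem romanSeries_mul {p : GradedSequence ℤ} (hp : IsRoman p) (h k : HahnSeries ℤ ℂ) :
    romanSeries p (h * k) = romanSeries p h * romanSeries p k := by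
  ext a
  rw [coeff_mul_eq_finsum, coeff_romanSeries, (hp h k a).2, div_eq_mul_inv, finsum_mul]
  refine finsum_congr fun b => ?_
  have hc : (romanCoeff (algebraMap ℤ ℝ a) (algebraMap ℤ ℝ b) : ℂ) =
      romC a / (romC b * romC (a - b)) := by
    simp [romanCoeff, romC]
  rw [hc, coeff_romanSeries, coeff_romanSeries]
  field_simp [romC_ne_zero a, romC_ne_zero b, romC_ne_zero (a - b)]

theorem coeff_romanSeries_single (p : GradedSequence ℤ) (d a : ℤ) :
    (romanSeries p (single d 1)).coeff a = romC d * p.coeff a d / romC a := by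
  rw [coeff_romanSeries, augment_single, one_mul]

theorem romanSeries_ne_zero (p : GradedSequence ℤ) (d : ℤ) : romanSeries p (single d 1) ≠ 0 := by
  intro h
  have h1 := coeff_romanSeries_single p d d
  rw [h, coeff_zero] at h1
  exact div_ne_zero (mul_ne_zero (romC_ne_zero d) (p.coeff_self d)) (romC_ne_zero d) h1.symm

theorem isDelta_romanSeries (p : GradedSequence ℤ) : IsDelta (romanSeries p (single 1 1)) := by
  constructor
  · intro a ha
    rw [coeff_romanSeries_single, p.coeff_of_lt a 1 ha, mul_zero, zero_div]
  · rw [coeff_romanSeries_single]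
    exact div_ne_zero (mul_ne_zero (romC_ne_zero 1) (p.coeff_self 1)) (romC_ne_zero 1)

/-- Both sides are multiplied by `e` when `d` increases by one, and `e ≠ 0` can be cancelled, so
induction runs in both directions. -/
theorem romanSeries_single {p : GradedSequence ℤ} (hp : IsRoman p) (d : ℤ) :
    romanSeries p (single d 1) = opPow (romanSeries p (single 1 1)) d := by
  set e := romanSeries p (single 1 1) with he
  have hstep : ∀ d : ℤ, romanSeries p (single (d + 1) 1) = romanSeries p (single d 1) * e := by
    intro d
    rw [he, ← romanSeries_mul hp, single_mul_single, one_mul]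
  have hpow : ∀ d : ℤ, opPow e (d + 1) = opPow e d * e := by
    intro d
    rw [opPow_add (isDelta_romanSeries p).2, opPow_one (isDelta_romanSeries p)]
  have hne : e ≠ 0 := romanSeries_ne_zero p 1
  induction d using Int.induction_on with
  | zero =>
    -- That `D^0` goes to `1` is not part of the Roman condition; it follows from `D^0 D = D` by
    -- cancelling `e`.
    refine mul_right_cancel₀ hne ?_
    rw [← hstep, ← hpow, zero_add, opPow_one (isDelta_romanSeries p)]
  | succ n ih => rw [hstep, ih, hpow]
  | pred n ih =>
    refine mul_right_cancel₀ hne ?_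
    rw [← hstep, ← hpow, sub_add_cancel, ih]

theorem eq_powerSequence_of_isRoman {p : GradedSequence ℤ} (hp : IsRoman p) :
    p = powerSequence (romanSeries p (single 1 1)) (isDelta_romanSeries p) := by
  ext a d
  rw [coeff_powerSequence, ← romanSeries_single hp, coeff_romanSeries_single]
  field_simp [romC_ne_zero a, romC_ne_zero d]

end DiscreteRoman

/-! ### The isomorphism and the equivalences -/

section Main

variable {A : Type} [CommRing A] [LinearOrder A] [IsStrictOrderedRing A] [Algebra A ℝ]
  {K : Set ℂ}

theorem isAssociated_iff (hK : IsPowerGroup A K) {f e : HahnSeries A ℂ} (hf : IsDeltaIn K f)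
    (he : IsDeltaIn K e) (hfe : opComp f e = opD A) (hef : opComp e f = opD A)
    (p : GradedSequence A) : IsAssociated f p ↔ p = powerSequence e (he.isDelta hK) :=
  ⟨eq_powerSequence_of_isAssociated hK hf he hef, fun h =>
    h ▸ isAssociated_powerSequence hK hf he hfe⟩

theorem delta_opComp_inv (hK : IsPowerGroup A K) (f : {f : HahnSeries A ℂ // IsDeltaIn K f}) :
    letI := deltaGroup hK
    opComp f.1 (f⁻¹).1 = opD A ∧ opComp (f⁻¹).1 f.1 = opD A := by
  let := deltaGroup hK
  exact ⟨congrArg Subtype.val (mul_inv_cancel f), congrArg Subtype.val (inv_mul_cancel f)⟩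

theorem exists_deltaIn_inverse (hK : IsPowerGroup A K) {f : HahnSeries A ℂ}
    (hf : IsDeltaIn K f) :
    ∃ e, IsDeltaIn K e ∧ opComp f e = opD A ∧ opComp e f = opD A := by
  let := deltaGroup hK
  exact ⟨_, ((⟨f, hf⟩ : {f : HahnSeries A ℂ // IsDeltaIn K f})⁻¹).2, delta_opComp_inv hK ⟨f, hf⟩⟩

/-- The correspondence between delta operators and their associated graded sequences. -/
def associatedEquiv (hK : IsPowerGroup A K) (ρ : GradedSequence A → Prop)
    (hρ : ∀ p, ρ p ↔ ∃ e, ∃ he : IsDeltaIn K e, p = powerSequence e (he.isDelta hK)) :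
    {f : HahnSeries A ℂ // IsDeltaIn K f} ≃ {p : GradedSequence A // ρ p} :=
  letI := deltaGroup hK
  Equiv.ofBijective
    (fun f => ⟨powerSequence (f⁻¹).1 ((f⁻¹).2.isDelta hK), (hρ _).2 ⟨_, (f⁻¹).2, rfl⟩⟩) <| by
      constructor
      · intro f g h
        exact inv_injective (Subtype.ext (powerSequence_injective
          ((f⁻¹).2.isDelta hK) ((g⁻¹).2.isDelta hK) (congrArg Subtype.val h)))
      · rintro ⟨p, hp⟩
        obtain ⟨e, he, rfl⟩ := (hρ p).1 hp
        refine ⟨(⟨e, he⟩ : {f : HahnSeries A ℂ // IsDeltaIn K f})⁻¹, Subtype.ext ?_⟩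
        simp only [inv_inv]

/-- The predicate `ρ` stands for the Roman condition over `ℤ` and the standard Roman condition over
`ℝ`; only its description by power sequences matters. -/
theorem group_isomorphism (hK : IsPowerGroup A K) (ρ : GradedSequence A → Prop)
    (hρ : ∀ p, ρ p ↔ ∃ e, ∃ he : IsDeltaIn K e, p = powerSequence e (he.isDelta hK)) :
    ∃ (_ : Group {f : HahnSeries A ℂ // IsDeltaIn K f})
      (_ : Group {p : GradedSequence A // ρ p})
      (Φ : {f : HahnSeries A ℂ // IsDeltaIn K f} ≃* {p : GradedSequence A // ρ p}),
      (∀ f g : {f : HahnSeries A ℂ // IsDeltaIn K f}, (f * g).1 = opComp f.1 g.1) ∧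
      (∀ p q : {p : GradedSequence A // ρ p}, (p * q).1 = p.1.umbral q.1) ∧
      (1 : {f : HahnSeries A ℂ // IsDeltaIn K f}).1 = opD A ∧
      (1 : {p : GradedSequence A // ρ p}).1 = GradedSequence.harmonic A ∧
      ∀ (f : {f : HahnSeries A ℂ // IsDeltaIn K f}) (p : GradedSequence A),
        IsAssociated f.1 p ↔ (Φ f).1 = p := by
  let := deltaGroup hK
  let E := associatedEquiv hK ρ hρ
  have hE : ∀ f, (E f).1 = powerSequence (f⁻¹).1 ((f⁻¹).2.isDelta hK) := fun _ => rfl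
  -- The group structure is transported along the bijection, which spares the group axioms for
  -- umbral composition; the product is identified with it afterwards.
  let : Group {p : GradedSequence A // ρ p} := E.symm.group
  have hEmul : ∀ f g, E (f * g) = E f * E g := fun f g => by
    change E (f * g) = E (E.symm (E f) * E.symm (E g))
    rw [E.symm_apply_apply, E.symm_apply_apply]
  have humbral : ∀ f g, (E (f * g)).1 = (E f).1.umbral (E g).1 := fun f g => by
    -- The reversal of order by umbral composition is undone by `(fg)⁻¹ = g⁻¹ f⁻¹`.
    rw [hE f, hE g, umbral_powerSequence hK (f⁻¹).2 (g⁻¹).2, hE]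
    congr 1
    exact congrArg Subtype.val (mul_inv_rev f g)
  refine ⟨inferInstance, inferInstance, MulEquiv.mk E hEmul, fun f g => rfl, fun p q => ?_, rfl,
    ?_, fun f p => ?_⟩
  · obtain ⟨f, rfl⟩ := E.surjective p
    obtain ⟨g, rfl⟩ := E.surjective q
    rw [← hEmul, humbral]
  · change (E 1).1 = _
    rw [hE, ← powerSequence_opD]
    congr 1
    exact congrArg Subtype.val inv_one
  · rw [isAssociated_iff hK f.2 (f⁻¹).2 (delta_opComp_inv hK f).1 (delta_opComp_inv hK f).2]
    exact eq_comm

/-- Under the isomorphism, conditions 1 and 4 both become `fg = 1`, and conditions 2 and 3 both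
become `gf = 1`. -/
theorem inverse_tfae (hK : IsPowerGroup A K) {f g : HahnSeries A ℂ} {p q : GradedSequence A}
    (hf : IsDeltaIn K f) (hg : IsDeltaIn K g) (hp : IsAssociated f p) (hq : IsAssociated g q) :
    [opComp f g = opD A, opComp g f = opD A,
      ∀ (n : A) (α : LogExp), (q.umbral p).series n α = harmonicLog n α,
      ∀ (n : A) (α : LogExp), (p.umbral q).series n α = harmonicLog n α].TFAE := by
  obtain ⟨_, _, Φ, hmul, humb, hone, hone', hass⟩ := group_isomorphism hK
    (fun p => ∃ e, ∃ he : IsDeltaIn K e, p = powerSequence e (he.isDelta hK)) fun _ => Iff.rfl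
  have hcomp : ∀ {f g : HahnSeries A ℂ} (hf : IsDeltaIn K f) (hg : IsDeltaIn K g),
      opComp f g = opD A ↔
        (⟨f, hf⟩ * ⟨g, hg⟩ : {f : HahnSeries A ℂ // IsDeltaIn K f}) = 1 := fun hf hg => by
    rw [Subtype.ext_iff, hmul, hone]
  have hseries : ∀ {f g : HahnSeries A ℂ} {p q : GradedSequence A} (hf : IsDeltaIn K f)
      (hg : IsDeltaIn K g), IsAssociated f p → IsAssociated g q →
      ((∀ (n : A) (α : LogExp), (p.umbral q).series n α = harmonicLog n α) ↔
        (⟨f, hf⟩ * ⟨g, hg⟩ : {f : HahnSeries A ℂ // IsDeltaIn K f}) = 1) := by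
    intro f g p q hf hg hp hq
    rw [series_eq_harmonicLog_iff, ← (hass ⟨f, hf⟩ p).1 hp, ← (hass ⟨g, hg⟩ q).1 hq, ← humb,
      ← hone', ← Subtype.ext_iff, ← map_mul, map_eq_one_iff Φ Φ.injective]
  rw [hcomp hf hg, hcomp hg hf, hseries hf hg hp hq, hseries hg hf hq hp]
  tfae_have 1 ↔ 2 := by rw [mul_eq_one_iff_eq_inv, mul_eq_one_iff_inv_eq, eq_comm]
  tfae_have 2 ↔ 3 := Iff.rfl
  tfae_have 1 ↔ 4 := Iff.rfl
  tfae_finish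

theorem isRoman_iff (p : GradedSequence ℤ) : IsRoman p ↔
    ∃ e, ∃ he : IsDeltaIn {c : ℂ | c ≠ 0} e,
      p = powerSequence e (he.isDelta isPowerGroup_ne_zero) := by
  constructor
  · exact fun hp => ⟨_, isDelta_romanSeries p, eq_powerSequence_of_isRoman hp⟩
  · rintro ⟨e, he, rfl⟩
    exact isRoman_powerSequence _

/-- A sequence associated with a standard `f` is the power sequence of the inverse of `f`;
conversely, the power sequence of `e` is associated with the inverse of `e`. -/
theorem isStandardRoman_iff (p : GradedSequence ℝ) : IsStandardRoman p ↔
    ∃ e, ∃ he : IsDeltaIn {c : ℂ | ∃ r : ℝ, 0 < r ∧ c = r} e,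
      p = powerSequence e (he.isDelta isPowerGroup_pos) := by
  constructor
  · rintro ⟨-, f, hf, hp⟩
    obtain ⟨e, he, -, hef⟩ := exists_deltaIn_inverse isPowerGroup_pos hf
    exact ⟨e, he, eq_powerSequence_of_isAssociated isPowerGroup_pos hf he hef hp⟩
  · rintro ⟨e, he, rfl⟩
    obtain ⟨f, hf, -, hfe⟩ := exists_deltaIn_inverse isPowerGroup_pos he
    exact ⟨isRoman_powerSequence _, f, hf, isAssociated_powerSequence isPowerGroup_pos hf he hfe⟩

end Main

end IterLog

end

theorem mainTheorem3 :
    -- the discrete theory: integer exponents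
    ((∀ (f g : HahnSeries ℤ ℂ) (p q : IterLog.GradedSequence ℤ),
        IterLog.IsDelta f → IterLog.IsDelta g →
        IterLog.IsAssociated f p → IterLog.IsAssociated g q →
        [IterLog.opComp f g = IterLog.opD ℤ,
          IterLog.opComp g f = IterLog.opD ℤ,
          ∀ (n : ℤ) (α : IterLog.LogExp), (q.umbral p).series n α = IterLog.harmonicLog n α,
          ∀ (n : ℤ) (α : IterLog.LogExp),
            (p.umbral q).series n α = IterLog.harmonicLog n α].TFAE) ∧
      ∃ (_ : Group {f : HahnSeries ℤ ℂ // IterLog.IsDelta f})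
        (_ : Group {p : IterLog.GradedSequence ℤ // IterLog.IsRoman p})
        (Φ : {f : HahnSeries ℤ ℂ // IterLog.IsDelta f} ≃*
          {p : IterLog.GradedSequence ℤ // IterLog.IsRoman p}),
        (∀ f g : {f : HahnSeries ℤ ℂ // IterLog.IsDelta f},
          (f * g).1 = IterLog.opComp f.1 g.1) ∧
        (∀ p q : {p : IterLog.GradedSequence ℤ // IterLog.IsRoman p},
          (p * q).1 = p.1.umbral q.1) ∧
        (1 : {f : HahnSeries ℤ ℂ // IterLog.IsDelta f}).1 = IterLog.opD ℤ ∧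
        (1 : {p : IterLog.GradedSequence ℤ // IterLog.IsRoman p}).1 =
          IterLog.GradedSequence.harmonic ℤ ∧
        ∀ (f : {f : HahnSeries ℤ ℂ // IterLog.IsDelta f}) (p : IterLog.GradedSequence ℤ),
          IterLog.IsAssociated f.1 p ↔ (Φ f).1 = p) ∧
    -- the continuous theory: real exponents
    ((∀ (f g : HahnSeries ℝ ℂ) (p q : IterLog.GradedSequence ℝ),
        IterLog.IsStandardDelta f → IterLog.IsStandardDelta g →
        IterLog.IsAssociated f p → IterLog.IsAssociated g q →
        [IterLog.opComp f g = IterLog.opD ℝ,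
          IterLog.opComp g f = IterLog.opD ℝ,
          ∀ (n : ℝ) (α : IterLog.LogExp), (q.umbral p).series n α = IterLog.harmonicLog n α,
          ∀ (n : ℝ) (α : IterLog.LogExp),
            (p.umbral q).series n α = IterLog.harmonicLog n α].TFAE) ∧
      ∃ (_ : Group {f : HahnSeries ℝ ℂ // IterLog.IsStandardDelta f})
        (_ : Group {p : IterLog.GradedSequence ℝ // IterLog.IsStandardRoman p})
        (Φ : {f : HahnSeries ℝ ℂ // IterLog.IsStandardDelta f} ≃*
          {p : IterLog.GradedSequence ℝ // IterLog.IsStandardRoman p}),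
        (∀ f g : {f : HahnSeries ℝ ℂ // IterLog.IsStandardDelta f},
          (f * g).1 = IterLog.opComp f.1 g.1) ∧
        (∀ p q : {p : IterLog.GradedSequence ℝ // IterLog.IsStandardRoman p},
          (p * q).1 = p.1.umbral q.1) ∧
        (1 : {f : HahnSeries ℝ ℂ // IterLog.IsStandardDelta f}).1 = IterLog.opD ℝ ∧
        (1 : {p : IterLog.GradedSequence ℝ // IterLog.IsStandardRoman p}).1 =
          IterLog.GradedSequence.harmonic ℝ ∧
        ∀ (f : {f : HahnSeries ℝ ℂ // IterLog.IsStandardDelta f})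
          (p : IterLog.GradedSequence ℝ),
          IterLog.IsAssociated f.1 p ↔ (Φ f).1 = p) := by
  refine ⟨⟨fun f g p q hf hg hp hq => ?_, ?_⟩, fun f g p q hf hg hp hq => ?_, ?_⟩
  · exact IterLog.inverse_tfae IterLog.isPowerGroup_ne_zero hf hg hp hq
  · exact IterLog.group_isomorphism IterLog.isPowerGroup_ne_zero _ IterLog.isRoman_iff
  · exact IterLog.inverse_tfae IterLog.isPowerGroup_pos hf hg hp hq
  · exact IterLog.group_isomorphism IterLog.isPowerGroup_pos _ IterLog.isStandardRoman_iff
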